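/- Let $d\ge 3$ and $k$ be fixed integers. For $n\ge 1$ with $dn$ even, let $G$ be a uniformly random $d$-regular simple graph on the vertex set $\{1,\dots,n\}$, and let $u,v$ be vertices chosen uniformly at random, with $G,u,v$ independent (so $u=v$ is allowed). For an integer $i$ let $N_i(u)$ be the set of vertices of $G$ at distance at most $i$ from $u$ (vertices in different components are at infinite distance, and $N_i(u)=\emptyset$ if $i<0$). Put $$i_0=\left\lfloor \tfrac12\log_{d-1}n\right\rfloor,\qquad \gamma(n,d)=\tfrac12\log_{d-1}n-i_0 .$$ Then, as $n\to\infty$ through integers with $dn$ even, $$\mathbb{P}\big(N_{i_0+k}(u)\cap N_{i_0+k}(v)=\emptyset\big)\sim\exp\left(-\frac{d\,(d-1)^{2k-2\gamma(n,d)}}{d-2}\right),$$ that is, the ratio of the two sides tends to $1$. -/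

import Mathlib

open Filter Asymptotics Topology

noncomputable section

namespace RandomRegular

open scoped Classical in
/-- The finite set of all `d`-regular simple graphs on the labelled vertex set `Fin n`. -/
def regularGraphs (n d : ℕ) : Finset (SimpleGraph (Fin n)) :=
  Finset.univ.filter fun G => G.IsRegularOfDegree d

/-- The sample space: a `d`-regular graph on `Fin n` together with an ordered pair of vertices,
which may coincide. -/
def sampleSpace (n d : ℕ) : Finset (SimpleGraph (Fin n) × Fin n × Fin n) :=
  regularGraphs n d ×ˢ Finset.univ

open scoped Classical in
/-- The probability that `E G u v` holds, where `G` is a uniformly random `d`-regular graph on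
`Fin n` and `u`, `v` are uniformly random vertices, with `G`, `u`, `v` independent. That is the
uniform distribution on `sampleSpace n d`. -/
def prob (n d : ℕ) (E : SimpleGraph (Fin n) → Fin n → Fin n → Prop) : ℝ :=
  (((sampleSpace n d).filter fun ω => E ω.1 ω.2.1 ω.2.2).card : ℝ) / ((sampleSpace n d).card : ℝ)

/-- The set `N_i(u)` of vertices at distance at most `i` from `u` in `G`. A vertex that is not
reachable from `u` is at infinite distance; the set is empty for `i < 0`. -/
def nbhd {V : Type*} (G : SimpleGraph V) (i : ℤ) (u : V) : Set V :=
  {w | G.Reachable u w ∧ (G.dist u w : ℤ) ≤ i}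

/-- `i₀ = ⌊(1/2) log_{d-1} n⌋`. -/
def i₀ (n d : ℕ) : ℤ := ⌊(1 / 2 : ℝ) * Real.logb ((d : ℝ) - 1) (n : ℝ)⌋

/-- `γ(n,d) = (1/2) log_{d-1} n - i₀`. -/
def γ (n d : ℕ) : ℝ := (1 / 2 : ℝ) * Real.logb ((d : ℝ) - 1) (n : ℝ) - (i₀ n d : ℝ)

/-- The filter of `n → ∞` along those `n` for which `d * n` is even, that is, with `n` even
if `d` is odd. -/
def atTopEven (d : ℕ) : Filter ℕ := atTop ⊓ 𝓟 {n : ℕ | Even (d * n)}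

end RandomRegular

end

/-! Two balls of radius `r` are disjoint exactly when `u` and `v` are at distance greater than `2r`.
So for fixed `u ≠ v` it suffices to follow the number of `d`-regular graphs with distance greater
than `m`, and to show that passing from `m` to `m + 1` multiplies it by about `exp(-d(d-1)^m/n)`.
The product over `m < 2r` is a geometric sum in the exponent, and `(d-1)^(2r) = n(d-1)^(2k-2γ)`
turns it into the stated limit.

For one step, write `m = a + b` with `a`, `b` about `m/2`. Distance greater than `m` means that the
`a`-ball at `u` and the `b`-ball at `v` are disjoint; distance greater than `m + 1` means that
moreover no edge (a link) joins them. Let `g(t)` be the sum of `t^(number of links)` over the graphs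
with disjoint balls, so that `g 1` and `g 0` are the two counts. Switching a link with a far edge
removes it without changing either ball, and this is reversible (`sum_removals_eq_sum_insertions`).
Each link has about `dn` removals, while insertions number about `d(d-1)^a · d(d-1)^b`, the product
of the numbers of edges leaving the balls. Hence `g' ≈ μ g` on `[0, 1]` with `μ = d(d-1)^m/n`, and
integrating gives `g 0 ≈ exp(-μ) g 1` (`abs_sub_exp_mul_le`).

That few balls fall short of tree growth is a second switching argument (`sum_card_redundant_le`,
`sum_defect_le`). Each step costs a proportion `O(1/√n)` of all graphs, and there are `O(log n)`
steps. Since `γ ≥ 0`, the limit expression is bounded away from `0`, so a vanishing additive error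
is enough. -/

noncomputable section

namespace RandomRegular

open scoped Classical

/-! ### Switchings, and balls that they leave unchanged -/

section Switching

set_option linter.unusedSectionVars false

variable {V : Type*} [Fintype V] [DecidableEq V]

/-- Replace the edges `xy`, `zw` of `G` by `xz`, `yw`. -/
def switch (G : SimpleGraph V) (x y z w : V) : SimpleGraph V where
  Adj p q :=
    (G.Adj p q ∧ ¬(p = x ∧ q = y) ∧ ¬(p = y ∧ q = x) ∧ ¬(p = z ∧ q = w) ∧ ¬(p = w ∧ q = z)) ∨
      (p ≠ q ∧ ((p = x ∧ q = z) ∨ (p = z ∧ q = x) ∨ (p = y ∧ q = w) ∨ (p = w ∧ q = y)))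
  symm := ⟨fun p q h => by
    have := G.adj_comm p q
    grind⟩
  loopless := ⟨fun p h => by
    have := G.loopless.irrefl p
    grind⟩

theorem switch_adj {G : SimpleGraph V} {x y z w p q : V} :
    (switch G x y z w).Adj p q ↔
    (G.Adj p q ∧ ¬(p = x ∧ q = y) ∧ ¬(p = y ∧ q = x) ∧ ¬(p = z ∧ q = w) ∧ ¬(p = w ∧ q = z)) ∨
      (p ≠ q ∧ ((p = x ∧ q = z) ∨ (p = z ∧ q = x) ∨ (p = y ∧ q = w) ∨ (p = w ∧ q = y))) :=
  Iff.rfl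

/-- The edges `xy`, `zw` of `G` can be replaced by `xz`, `yw`. -/
structure Switchable (G : SimpleGraph V) (x y z w : V) : Prop where
  adj_left : G.Adj x y
  adj_right : G.Adj z w
  not_adj_left : ¬G.Adj x z
  not_adj_right : ¬G.Adj y w
  ne_left : x ≠ z
  ne_right : y ≠ w

theorem Switchable.reverse {G : SimpleGraph V} {x y z w : V} (h : Switchable G x y z w) :
    Switchable (switch G x y z w) x z y w := by
  obtain ⟨h1, h2, h3, h4, h5, h6⟩ := h
  have := h1.ne
  have := h2.ne
  have h1' := h1.symm
  have h2' := h2.symm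
  constructor <;> try simp only [switch_adj]
  all_goals grind

theorem Switchable.switch_reverse {G : SimpleGraph V} {x y z w : V} (h : Switchable G x y z w) :
    switch (switch G x y z w) x z y w = G := by
  obtain ⟨h1, h2, h3, h4, h5, h6⟩ := h
  have := h1.ne
  have := h2.ne
  have h1' := h1.symm
  have h2' := h2.symm
  have h3' : ¬ G.Adj z x := fun h => h3 h.symm
  have h4' : ¬ G.Adj w y := fun h => h4 h.symm
  ext p q
  have := fun h : G.Adj p q => h.ne
  simp only [switch_adj]
  grind

theorem switch_adj_of_ne {G : SimpleGraph V} {x y z w p : V} (hx : p ≠ x) (hy : p ≠ y)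
    (hz : p ≠ z) (hw : p ≠ w) (q : V) : (switch G x y z w).Adj p q ↔ G.Adj p q := by
  simp only [switch_adj]
  grind

/-- `G` is `d`-regular. -/
def IsReg (G : SimpleGraph V) (d : ℕ) : Prop :=
  ∀ v, (Finset.univ.filter (G.Adj v)).card = d

theorem Switchable.isReg {G : SimpleGraph V} {x y z w : V} (h : Switchable G x y z w) {d : ℕ}
    (hG : IsReg G d) : IsReg (switch G x y z w) d := by
  obtain ⟨h1, h2, h3, h4, h5, h6⟩ := h
  have := h1.ne
  have := h2.ne
  have h1' := h1.symm
  have h2' := h2.symm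
  have h3' : ¬ G.Adj z x := fun h => h3 h.symm
  have h4' : ¬ G.Adj w y := fun h => h4 h.symm
  have key : ∀ p s t : V, G.Adj p s → ¬ G.Adj p t →
      (∀ q, (switch G x y z w).Adj p q ↔ (q = t ∨ (q ≠ s ∧ G.Adj p q))) →
      (Finset.univ.filter ((switch G x y z w).Adj p)).card = d := by
    intro p s t hs ht hq
    have e : Finset.univ.filter ((switch G x y z w).Adj p)
        = insert t ((Finset.univ.filter (G.Adj p)).erase s) := by
      ext q
      simp [hq]
    have hs' : s ∈ Finset.univ.filter (G.Adj p) := by simpa using hs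
    rw [e, Finset.card_insert_of_notMem (by simp [ht]), Finset.card_erase_of_mem hs', hG p]
    have : 0 < d := by rw [← hG p]; exact Finset.card_pos.2 ⟨s, hs'⟩
    omega
  intro p
  by_cases hx : p = x
  · subst hx
    exact key p y z h1 h3 fun q => by simp only [switch_adj]; grind
  by_cases hy : p = y
  · subst hy
    exact key p x w h1' h4 fun q => by simp only [switch_adj]; grind
  by_cases hz : p = z
  · subst hz
    exact key p w x h2 h3' fun q => by simp only [switch_adj]; grind
  by_cases hw : p = w
  · subst hw
    exact key p z y h2' h4' fun q => by simp only [switch_adj]; grind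
  · rw [← hG p]
    congr 1
    ext q
    simp [switch_adj_of_ne hx hy hz hw]

/-- The vertices at distance at most `i` from `u`. -/
def ball (G : SimpleGraph V) (u : V) : ℕ → Finset V
  | 0 => {u}
  | i + 1 => Finset.univ.filter fun w => w ∈ ball G u i ∨ ∃ x ∈ ball G u i, G.Adj x w

theorem mem_ball_zero {G : SimpleGraph V} {u w : V} : w ∈ ball G u 0 ↔ w = u := by
  simp [ball]

theorem mem_ball_succ {G : SimpleGraph V} {u w : V} {i : ℕ} :
    w ∈ ball G u (i + 1) ↔ w ∈ ball G u i ∨ ∃ x ∈ ball G u i, G.Adj x w := by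
  simp [ball]

theorem ball_mono {G : SimpleGraph V} {u : V} : Monotone (ball G u) :=
  monotone_nat_of_le_succ fun _ _ h => mem_ball_succ.2 (Or.inl h)

theorem mem_ball_of_adj {G : SimpleGraph V} {u x y : V} {i j : ℕ} (hij : i < j)
    (hx : x ∈ ball G u i) (h : G.Adj x y) : y ∈ ball G u j :=
  ball_mono (show i + 1 ≤ j from hij) (mem_ball_succ.2 (Or.inr ⟨x, hx, h⟩))

/-- Growing a ball to radius `a` only inspects edges at vertices at distance less than `a`. Edges
may therefore change at distance exactly `a`, which is where the switchings below act. -/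
theorem ball_congr {G H : SimpleGraph V} {u : V} {a : ℕ}
    (h : ∀ i < a, ∀ p ∈ ball G u i, ∀ q, H.Adj p q ↔ G.Adj p q) {i : ℕ} (hi : i ≤ a) :
    ball H u i = ball G u i := by
  induction i with
  | zero => rfl
  | succ i ih =>
    ext w
    rw [mem_ball_succ, mem_ball_succ, ih (by omega)]
    refine or_congr_right (exists_congr fun x => and_congr_right fun hx => ?_)
    exact h i (by omega) x hx w

theorem ball_switch {G : SimpleGraph V} {u x y z w : V} {a : ℕ}
    (hx : ∀ i < a, x ∉ ball G u i) (hy : ∀ i < a, y ∉ ball G u i)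
    (hz : ∀ i < a, z ∉ ball G u i) (hw : ∀ i < a, w ∉ ball G u i) {i : ℕ} (hi : i ≤ a) :
    ball (switch G x y z w) u i = ball G u i :=
  ball_congr (fun j hj p hp q => switch_adj_of_ne
    (fun e => hx j hj (by rwa [← e])) (fun e => hy j hj (by rwa [← e]))
    (fun e => hz j hj (by rwa [← e])) (fun e => hw j hj (by rwa [← e])) q) hi

theorem notMem_ball_of_lt {G : SimpleGraph V} {u x : V} {a : ℕ} (hx : x ∉ ball G u a) :
    ∀ i < a, x ∉ ball G u i :=
  fun _ hi h => hx (ball_mono hi.le h)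

theorem notMem_ball_of_adj {G : SimpleGraph V} {u x y : V} {a : ℕ} (h : G.Adj x y)
    (hy : y ∉ ball G u a) : ∀ i < a, x ∉ ball G u i :=
  fun _ hi hx => hy (mem_ball_of_adj hi hx h)

/-- The recursion for balls extends a path at its far end; this extends it at the centre, as needed
to split a path at an intermediate vertex. -/
theorem mem_ball_succ_center {G : SimpleGraph V} {w x : V} {b : ℕ} :
    x ∈ ball G w (b + 1) ↔ x ∈ ball G w b ∨ ∃ y, G.Adj y w ∧ x ∈ ball G y b := by
  induction b generalizing x with
  | zero =>
    simp only [mem_ball_succ, mem_ball_zero]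
    have := G.adj_comm
    grind
  | succ b ih =>
    constructor
    · intro h
      rcases mem_ball_succ.1 h with h | ⟨x', hx', h⟩
      · exact Or.inl h
      · rcases ih.1 hx' with h' | ⟨y, hy, h'⟩
        · exact Or.inl (mem_ball_succ.2 (Or.inr ⟨x', h', h⟩))
        · exact Or.inr ⟨y, hy, mem_ball_succ.2 (Or.inr ⟨x', h', h⟩)⟩
    · rintro (h | ⟨y, hy, h⟩)
      · exact mem_ball_succ.2 (Or.inl h)
      · rcases mem_ball_succ.1 h with h | ⟨x', hx', h⟩
        · exact mem_ball_succ.2 (Or.inl (ih.2 (Or.inr ⟨y, hy, h⟩)))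
        · exact mem_ball_succ.2 (Or.inr ⟨x', ih.2 (Or.inr ⟨y, hy, hx'⟩), h⟩)

theorem mem_ball_add {G : SimpleGraph V} {u w : V} {a b : ℕ} :
    w ∈ ball G u (a + b) ↔ ∃ x, x ∈ ball G u a ∧ x ∈ ball G w b := by
  induction b generalizing w with
  | zero => simp [mem_ball_zero]
  | succ b ih =>
    rw [← add_assoc, mem_ball_succ]
    constructor
    · rintro (h | ⟨y, hy, h⟩)
      · obtain ⟨x, hx, h⟩ := ih.1 h
        exact ⟨x, hx, mem_ball_succ_center.2 (Or.inl h)⟩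
      · obtain ⟨x, hx, h'⟩ := ih.1 hy
        exact ⟨x, hx, mem_ball_succ_center.2 (Or.inr ⟨y, h, h'⟩)⟩
    · rintro ⟨x, hx, h⟩
      rcases mem_ball_succ_center.1 h with h | ⟨y, hy, h⟩
      · exact Or.inl (ih.2 ⟨x, hx, h⟩)
      · exact Or.inr ⟨y, ih.2 ⟨x, hx, h⟩, hy⟩

/-- Only `a + b` matters, so a given distance can be split into whichever two radii are convenient.
-/
theorem disjoint_ball_iff {G : SimpleGraph V} {u v : V} {a b : ℕ} :
    Disjoint (ball G u a) (ball G v b) ↔ v ∉ ball G u (a + b) := by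
  rw [mem_ball_add, Finset.disjoint_left]
  push Not
  rfl

end Switching

/-! ### Counting darts, growth of balls, and available switchings -/

section Counting

set_option linter.unusedSectionVars false

variable {V : Type*} [Fintype V] [DecidableEq V]

/-- The ordered pairs of adjacent vertices from `X` to `Z`. -/
def darts (G : SimpleGraph V) (X Z : Finset V) : Finset (V × V) :=
  Finset.univ.filter fun p => p.1 ∈ X ∧ p.2 ∈ Z ∧ G.Adj p.1 p.2

theorem mem_darts {G : SimpleGraph V} {X Z : Finset V} {p : V × V} :
    p ∈ darts G X Z ↔ p.1 ∈ X ∧ p.2 ∈ Z ∧ G.Adj p.1 p.2 := by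
  simp [darts]

theorem card_filter_fst (P : V → V → Prop) (X : Finset V) :
    (Finset.univ.filter fun p : V × V => p.1 ∈ X ∧ P p.1 p.2).card
      = ∑ x ∈ X, (Finset.univ.filter fun z => P x z).card := by
  rw [Finset.card_eq_sum_card_fiberwise (f := Prod.fst) (t := X)
    (fun p hp => by simp at hp; exact hp.1)]
  refine Finset.sum_congr rfl fun x hx => ?_
  refine Finset.card_bij' (fun p _ => p.2) (fun z _ => (x, z)) ?_ ?_ ?_ ?_
  · rintro ⟨a, b⟩ h
    simp at h ⊢
    obtain ⟨⟨_, h⟩, rfl⟩ := h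
    exact h
  · intro z h
    simp at h ⊢
    exact ⟨hx, h⟩
  · rintro ⟨a, b⟩ h
    simp at h ⊢
    exact h.2.symm
  · intro z h
    rfl

theorem card_darts (G : SimpleGraph V) (X Z : Finset V) :
    (darts G X Z).card = ∑ x ∈ X, (Finset.univ.filter fun z => z ∈ Z ∧ G.Adj x z).card := by
  refine Eq.trans ?_ ((card_filter_fst (fun x z => z ∈ Z ∧ G.Adj x z) X).trans (by congr!))
  unfold darts
  congr!

theorem card_darts_swap (G : SimpleGraph V) (X Z : Finset V) :
    (darts G X Z).card = (darts G Z X).card := by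
  refine Finset.card_bij' (fun p _ => p.swap) (fun p _ => p.swap) ?_ ?_ ?_ ?_
  · intro p h
    rw [mem_darts] at h ⊢
    exact ⟨h.2.1, h.1, h.2.2.symm⟩
  · intro p h
    rw [mem_darts] at h ⊢
    exact ⟨h.2.1, h.1, h.2.2.symm⟩
  · intro p _
    simp
  · intro p _
    simp

theorem card_darts_univ {G : SimpleGraph V} {d : ℕ} (hG : IsReg G d) (X : Finset V) :
    (darts G X Finset.univ).card = d * X.card := by
  rw [card_darts, Finset.sum_congr rfl (fun x _ => by simpa using hG x)]
  simp [mul_comm]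

theorem card_darts_le {G : SimpleGraph V} {d : ℕ} (hG : IsReg G d) (X Z : Finset V) :
    (darts G X Z).card ≤ d * X.card := by
  rw [← card_darts_univ hG]
  refine Finset.card_le_card fun p hp => ?_
  rw [mem_darts] at hp ⊢
  exact ⟨hp.1, Finset.mem_univ _, hp.2.2⟩

theorem card_darts_univ_left_le {G : SimpleGraph V} {d : ℕ} (hG : IsReg G d) (X Z : Finset V) :
    (darts G X Z).card ≤ d * Z.card := by
  rw [card_darts_swap]
  exact card_darts_le hG Z X

/-- The number of edges leaving the ball of radius `i`. -/
def boundary (G : SimpleGraph V) (u : V) (i : ℕ) : ℕ :=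
  (darts G (ball G u i) (ball G u i)ᶜ).card

/-- The darts within the ball of radius `i + 1`, ending in its outer sphere, whose removal leaves
their endpoints in that ball. -/
def redundant (G : SimpleGraph V) (u : V) (i : ℕ) : Finset (V × V) :=
  Finset.univ.filter fun p => p.1 ∈ ball G u (i + 1) ∧ p.2 ∈ ball G u (i + 1) ∧ p.2 ∉ ball G u i ∧
    G.Adj p.1 p.2 ∧ ∃ x ∈ ball G u i, x ≠ p.1 ∧ G.Adj x p.2

theorem boundary_zero {G : SimpleGraph V} {d : ℕ} (hG : IsReg G d) (u : V) :
    boundary G u 0 = d := by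
  rw [boundary, card_darts]
  simp only [ball, Finset.sum_singleton]
  rw [← hG u]
  congr 1
  ext z
  simp only [Finset.mem_filter, Finset.mem_univ, true_and, Finset.mem_compl, Finset.mem_singleton]
  exact ⟨fun h => h.2, fun h => ⟨h.ne', h⟩⟩

section Layer

variable (G : SimpleGraph V) (u : V) (i : ℕ)

/-- The vertices at distance `i + 1` from `u`. -/
def layer : Finset V := ball G u (i + 1) \ ball G u i

theorem boundary_eq_sum_layer :
    boundary G u i
      = ∑ y ∈ layer G u i, (Finset.univ.filter fun z => z ∈ ball G u i ∧ G.Adj y z).card := by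
  rw [← card_darts, card_darts_swap, boundary]
  congr 1
  ext p
  simp only [mem_darts, layer, Finset.mem_compl, Finset.mem_sdiff]
  have := fun (h : p.1 ∈ ball G u i) (h' : G.Adj p.1 p.2) => mem_ball_of_adj (Nat.lt_succ_self i) h h'
  tauto

theorem boundary_succ_eq_sum_layer :
    boundary G u (i + 1)
      = ∑ y ∈ layer G u i, (Finset.univ.filter fun z => z ∈ (ball G u (i + 1))ᶜ ∧ G.Adj y z).card := by
  rw [← card_darts, boundary]
  congr 1
  ext p
  simp only [mem_darts, layer, Finset.mem_compl, Finset.mem_sdiff]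
  have := fun (h : p.1 ∈ ball G u i) (h' : G.Adj p.1 p.2) => mem_ball_of_adj (Nat.lt_succ_self i) h h'
  tauto

variable {G u i} in
theorem one_le_card_parents {y : V} (hy : y ∈ layer G u i) :
    1 ≤ (Finset.univ.filter fun z => z ∈ ball G u i ∧ G.Adj y z).card := by
  rw [layer, Finset.mem_sdiff, mem_ball_succ] at hy
  obtain ⟨h | ⟨x, hx, h⟩, h'⟩ := hy
  · exact absurd h h'
  · exact Finset.card_pos.2 ⟨x, by simpa using ⟨hx, h.symm⟩⟩

variable {G} in
theorem card_neighbors_split {d : ℕ} (hG : IsReg G d) (y : V) :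
    (Finset.univ.filter fun z => z ∈ ball G u i ∧ G.Adj y z).card
      + (Finset.univ.filter fun z => z ∈ layer G u i ∧ G.Adj y z).card
      + (Finset.univ.filter fun z => z ∈ (ball G u (i + 1))ᶜ ∧ G.Adj y z).card = d := by
  have hm : ball G u i ⊆ ball G u (i + 1) := ball_mono (Nat.le_succ i)
  rw [← hG y, ← Finset.card_union_of_disjoint, ← Finset.card_union_of_disjoint]
  · congr 1
    ext z
    have := @hm z
    simp only [layer, Finset.mem_union, Finset.mem_filter, Finset.mem_univ, true_and,
      Finset.mem_compl, Finset.mem_sdiff]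
    tauto
  · rw [Finset.disjoint_left]
    intro z
    have := @hm z
    simp only [layer, Finset.mem_union, Finset.mem_filter, Finset.mem_univ, true_and,
      Finset.mem_compl, Finset.mem_sdiff]
    tauto
  · rw [Finset.disjoint_left]
    intro z
    simp only [layer, Finset.mem_filter, Finset.mem_univ, true_and, Finset.mem_sdiff]
    tauto

theorem card_redundant :
    (redundant G u i).card = ∑ y ∈ layer G u i, (Finset.univ.filter fun x =>
      x ∈ ball G u (i + 1) ∧ G.Adj x y ∧ ∃ x' ∈ ball G u i, x' ≠ x ∧ G.Adj x' y).card := by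
  have h := card_filter_fst (fun y x => x ∈ ball G u (i + 1) ∧ G.Adj x y ∧
    ∃ x' ∈ ball G u i, x' ≠ x ∧ G.Adj x' y) (layer G u i)
  refine Eq.trans ?_ (h.trans (by congr!))
  refine Finset.card_bij' (fun p _ => p.swap) (fun p _ => p.swap) ?_ ?_ ?_ ?_
  · intro p h
    simp only [redundant, layer, Finset.mem_filter, Finset.mem_univ, true_and,
      Finset.mem_sdiff, Prod.fst_swap, Prod.snd_swap] at h ⊢
    tauto
  · intro p h
    simp only [redundant, layer, Finset.mem_filter, Finset.mem_univ, true_and,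
      Finset.mem_sdiff, Prod.fst_swap, Prod.snd_swap] at h ⊢
    tauto
  · intro p _
    simp
  · intro p _
    simp

variable {G u i} in
-- If `y` has two neighbours in the inner ball, every dart into `y` from the larger ball is
-- redundant. If it has only one, the dart from that neighbour is the sole exception.
theorem card_le_card_redundant_fiber {y : V} (hy : y ∈ layer G u i) :
    (Finset.univ.filter fun z => z ∈ ball G u i ∧ G.Adj y z).card
      + (Finset.univ.filter fun z => z ∈ layer G u i ∧ G.Adj y z).card
      ≤ (Finset.univ.filter fun x =>
      x ∈ ball G u (i + 1) ∧ G.Adj x y ∧ ∃ x' ∈ ball G u i, x' ≠ x ∧ G.Adj x' y).card + 1 := by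
  have hm : ball G u i ⊆ ball G u (i + 1) := ball_mono (Nat.le_succ i)
  obtain ⟨x₀, hx₀⟩ := Finset.card_pos.1 (one_le_card_parents hy)
  rw [← Finset.card_union_of_disjoint]
  · have hx₀' := hx₀
    simp only [Finset.mem_filter, Finset.mem_univ, true_and] at hx₀'
    by_cases h2 : ∃ x₁ ∈ ball G u i, x₁ ≠ x₀ ∧ G.Adj x₁ y
    · refine (Finset.card_le_card fun z hz => ?_).trans (Nat.le_succ _)
      have := @hm z
      have := G.adj_comm
      simp only [layer, Finset.mem_union, Finset.mem_filter, Finset.mem_univ, true_and,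
        Finset.mem_sdiff] at hz ⊢
      refine ⟨by tauto, by grind, ?_⟩
      by_cases e : z = x₀
      · subst e
        exact h2
      · exact ⟨x₀, hx₀'.1, Ne.symm e, hx₀'.2.symm⟩
    · rw [← Nat.sub_le_iff_le_add, ← Finset.card_erase_of_mem (Finset.mem_union_left _ hx₀)]
      refine Finset.card_le_card fun z hz => ?_
      have := @hm z
      have := G.adj_comm
      simp only [layer, Finset.mem_union, Finset.mem_filter, Finset.mem_univ, true_and,
        Finset.mem_sdiff, Finset.mem_erase] at hz ⊢
      exact ⟨by tauto, by grind, ⟨x₀, hx₀'.1, Ne.symm hz.1, hx₀'.2.symm⟩⟩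
  · rw [Finset.disjoint_left]
    intro z
    simp only [layer, Finset.mem_filter, Finset.mem_univ, true_and, Finset.mem_sdiff]
    tauto

variable {G} in
-- In a tree the boundary grows by the factor `d - 1` exactly. At a vertex of the layer with `D`
-- inner, `F` lateral and `U` outer neighbours and `R` redundant darts, `D + F + U = d` and `D + F ≤
-- R + 1` give `(d-1)D ≤ U + dR`.
theorem mul_boundary_le {d : ℕ} (hd : 1 ≤ d) (hG : IsReg G d) :
    (d - 1) * boundary G u i ≤ boundary G u (i + 1) + d * (redundant G u i).card := by
  rw [boundary_eq_sum_layer, boundary_succ_eq_sum_layer, card_redundant, Finset.mul_sum,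
    Finset.mul_sum, ← Finset.sum_add_distrib]
  refine Finset.sum_le_sum fun y hy => ?_
  have h1 := card_neighbors_split u i hG y
  have h2 := card_le_card_redundant_fiber hy
  obtain ⟨e, rfl⟩ : ∃ e, d = e + 1 := ⟨d - 1, by omega⟩
  simp only [Nat.add_sub_cancel]
  generalize (Finset.univ.filter fun z => z ∈ ball G u i ∧ G.Adj y z).card = D at *
  generalize (Finset.univ.filter fun z => z ∈ layer G u i ∧ G.Adj y z).card = F at *
  generalize (Finset.univ.filter fun z => z ∈ (ball G u (i + 1))ᶜ ∧ G.Adj y z).card = U at *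
  generalize (Finset.univ.filter fun x =>
      x ∈ ball G u (i + 1) ∧ G.Adj x y ∧ ∃ x' ∈ ball G u i, x' ≠ x ∧ G.Adj x' y).card = R at *
  nlinarith [Nat.mul_le_mul_left e h2, Nat.zero_le (e * F)]

variable {G} in
theorem boundary_succ_le {d : ℕ} (hd : 1 ≤ d) (hG : IsReg G d) :
    boundary G u (i + 1) ≤ (d - 1) * boundary G u i := by
  rw [boundary_succ_eq_sum_layer, boundary_eq_sum_layer, Finset.mul_sum]
  refine Finset.sum_le_sum fun y hy => ?_
  have h1 := card_neighbors_split u i hG y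
  have h2 := one_le_card_parents hy
  obtain ⟨e, rfl⟩ : ∃ e, d = e + 1 := ⟨d - 1, by omega⟩
  simp only [Nat.add_sub_cancel]
  nlinarith

variable {G} in
theorem boundary_le {d : ℕ} (hd : 1 ≤ d) (hG : IsReg G d) :
    boundary G u i ≤ d * (d - 1) ^ i := by
  induction i with
  | zero => simp [boundary_zero hG]
  | succ i ih =>
    refine (boundary_succ_le u i hd hG).trans ?_
    rw [pow_succ]
    calc _ ≤ (d - 1) * (d * (d - 1) ^ i) := Nat.mul_le_mul_left _ ih
      _ = _ := by ring

variable {G} in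
theorem card_ball_le {d : ℕ} (hd : 3 ≤ d) (hG : IsReg G d) :
    (ball G u i).card ≤ d * (d - 1) ^ i := by
  induction i with
  | zero => simp [ball]; omega
  | succ i ih =>
    have h1 : (ball G u (i + 1)).card = (layer G u i).card + (ball G u i).card :=
      (Finset.card_sdiff_add_card_eq_card (ball_mono (Nat.le_succ i))).symm
    have h2 : (layer G u i).card ≤ boundary G u i := by
      rw [boundary_eq_sum_layer, Finset.card_eq_sum_ones]
      exact Finset.sum_le_sum fun y hy => one_le_card_parents hy
    have h3 := boundary_le u i (by omega) hG
    -- The bound at least doubles with each radius because `d - 1 ≥ 2`, so it covers the old ball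
    -- and the new layer together.
    calc _ ≤ 2 * (d * (d - 1) ^ i) := by omega
      _ ≤ (d - 1) * (d * (d - 1) ^ i) := Nat.mul_le_mul_right _ (by omega)
      _ = _ := by rw [pow_succ]; ring

end Layer

theorem card_darts_avoiding {G : SimpleGraph V} {d : ℕ} (hG : IsReg G d) (T : Finset V) (x y : V) :
    d * Fintype.card V ≤ ((darts G Tᶜ Tᶜ).filter fun p => ¬G.Adj x p.1 ∧ ¬G.Adj y p.2).card
      + (2 * (d * T.card) + 2 * (d * d)) := by
  have h : darts G Finset.univ Finset.univ ⊆
      ((darts G Tᶜ Tᶜ).filter fun p => ¬G.Adj x p.1 ∧ ¬G.Adj y p.2) ∪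
        ((darts G T Finset.univ ∪ darts G Finset.univ T) ∪
        (darts G (Finset.univ.filter (G.Adj x)) Finset.univ ∪
          darts G Finset.univ (Finset.univ.filter (G.Adj y)))) := by
    intro p
    simp only [mem_darts, Finset.mem_union, Finset.mem_filter, Finset.mem_univ, true_and,
      Finset.mem_compl]
    tauto
  have h1 := card_darts_le hG T Finset.univ
  have h2 := card_darts_univ_left_le hG Finset.univ T
  have h3 := card_darts_le hG (Finset.univ.filter (G.Adj x)) Finset.univ
  have h4 := card_darts_univ_left_le hG Finset.univ (Finset.univ.filter (G.Adj y))
  rw [hG] at h3 h4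
  have h0 := card_darts_univ hG Finset.univ
  rw [Finset.card_univ] at h0
  rw [← h0]
  refine (Finset.card_le_card h).trans ((Finset.card_union_le _ _).trans ?_)
  refine Nat.add_le_add_left ((Finset.card_union_le _ _).trans ?_) _
  have h5 := Finset.card_union_le (darts G T Finset.univ) (darts G Finset.univ T)
  have h6 := Finset.card_union_le (darts G (Finset.univ.filter (G.Adj x)) Finset.univ)
    (darts G Finset.univ (Finset.univ.filter (G.Adj y)))
  omega

theorem card_filter_product_le {α : Type*} (s t : Finset α) (P : α → α → Prop) (m : ℕ)
    (h : ∀ a ∈ s, ∃ X : Finset α, (∀ b ∈ t, P a b → b ∈ X) ∧ X.card ≤ m) :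
    ((s ×ˢ t).filter fun q => P q.1 q.2).card ≤ s.card * m := by
  rw [Finset.card_filter, Finset.sum_product]
  refine (Finset.sum_le_card_nsmul s _ m fun a ha => ?_).trans_eq (by simp)
  rw [← Finset.card_filter]
  obtain ⟨X, hX, hm⟩ := h a ha
  exact (Finset.card_le_card fun b hb => hX b (Finset.mem_filter.1 hb).1
    (Finset.mem_filter.1 hb).2).trans hm

/-- For a fixed first dart, the second is bad only if the tails are adjacent, or the heads are equal
or adjacent: at most `d² + d + d²` choices. The tails differ since `A` and `B` are disjoint. -/
theorem card_switchable_pairs {G : SimpleGraph V} {d : ℕ} (hG : IsReg G d) {A B C : Finset V}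
    (hAB : Disjoint A B) :
    (darts G A C).card * (darts G B C).card ≤
      ((darts G A C ×ˢ darts G B C).filter fun q =>
        Switchable G q.1.1 q.1.2 q.2.1 q.2.2).card + (darts G A C).card * (2 * (d * d) + d) := by
  have h : darts G A C ×ˢ darts G B C ⊆
      ((darts G A C ×ˢ darts G B C).filter fun q => Switchable G q.1.1 q.1.2 q.2.1 q.2.2) ∪
      ((darts G A C ×ˢ darts G B C).filter fun q =>
        G.Adj q.1.1 q.2.1 ∨ (q.1.2 = q.2.2 ∨ G.Adj q.1.2 q.2.2)) := by
    intro q hq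
    have hq' := hq
    simp only [Finset.mem_product, mem_darts] at hq'
    simp only [Finset.mem_union, Finset.mem_filter, hq, true_and]
    by_contra hcon
    push Not at hcon
    refine hcon.1 ⟨hq'.1.2.2, hq'.2.2.2, hcon.2.1, hcon.2.2.2, ?_, hcon.2.2.1⟩
    intro e
    exact Finset.disjoint_left.1 hAB hq'.1.1 (e ▸ hq'.2.1)
  rw [← Finset.card_product]
  refine (Finset.card_le_card h).trans ((Finset.card_union_le _ _).trans ?_)
  refine Nat.add_le_add_left ?_ _
  have h0 := card_filter_product_le (darts G A C) (darts G B C)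
    (fun e f => G.Adj e.1 f.1 ∨ (e.2 = f.2 ∨ G.Adj e.2 f.2)) (2 * (d * d) + d) ?_
  · convert h0
  intro e _
  have h1 := card_darts_le hG (Finset.univ.filter (G.Adj e.1)) Finset.univ
  have h2 := card_darts_univ_left_le hG Finset.univ {e.2}
  have h3 := card_darts_univ_left_le hG Finset.univ (Finset.univ.filter (G.Adj e.2))
  rw [hG] at h1 h3
  rw [Finset.card_singleton] at h2
  refine ⟨darts G (Finset.univ.filter (G.Adj e.1)) Finset.univ ∪ (darts G Finset.univ {e.2} ∪
      darts G Finset.univ (Finset.univ.filter (G.Adj e.2))), ?_, ?_⟩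
  · intro f
    simp only [mem_darts, Finset.mem_union, Finset.mem_filter, Finset.mem_univ, true_and,
      Finset.mem_singleton]
    have : e.2 = f.2 ↔ f.2 = e.2 := eq_comm
    tauto
  refine (Finset.card_union_le _ _).trans ?_
  have h5 := Finset.card_union_le (darts G Finset.univ {e.2})
    (darts G Finset.univ (Finset.univ.filter (G.Adj e.2)))
  omega

end Counting

/-! ### Double counting by switchings -/

section DoubleCounting

set_option linter.unusedSectionVars false

variable {V : Type*} [Fintype V] [DecidableEq V]

variable (V) in
/-- The finite set of `d`-regular graphs on `V`. -/
def regs (d : ℕ) : Finset (SimpleGraph V) := Finset.univ.filter fun G => IsReg G d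

theorem mem_regs {G : SimpleGraph V} {d : ℕ} : G ∈ regs V d ↔ IsReg G d := by
  simp [regs]

/-- Switching, as an operation on graphs together with two darts. -/
def switchPair (τ : Σ _ : SimpleGraph V, (V × V) × (V × V)) :
    Σ _ : SimpleGraph V, (V × V) × (V × V) :=
  ⟨switch τ.1 τ.2.1.1 τ.2.1.2 τ.2.2.1 τ.2.2.2, ((τ.2.1.1, τ.2.2.1), (τ.2.1.2, τ.2.2.2))⟩

theorem switchPair_switchPair {τ : Σ _ : SimpleGraph V, (V × V) × (V × V)}
    (h : Switchable τ.1 τ.2.1.1 τ.2.1.2 τ.2.2.1 τ.2.2.2) : switchPair (switchPair τ) = τ := by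
  obtain ⟨G, ⟨x, y⟩, ⟨z, w⟩⟩ := τ
  simp only [switchPair]
  rw [h.switch_reverse]

theorem le_card_filter_product {α : Type*} (s t : Finset α) (P : α → α → Prop) (m : ℕ)
    (h : ∀ a ∈ s, m ≤ (t.filter (P a)).card) :
    s.card * m ≤ ((s ×ˢ t).filter fun q => P q.1 q.2).card := by
  rw [Finset.card_filter, Finset.sum_product]
  refine le_trans (by simp) (Finset.card_nsmul_le_sum s _ m fun a ha => ?_)
  rw [← Finset.card_filter]
  exact h a ha

theorem card_mul_le_card_darts_pairs {G : SimpleGraph V} {d : ℕ} (hG : IsReg G d)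
    (s : Finset (V × V)) (T : Finset V) {m : ℕ} (hm : 2 * (d * T.card) + 2 * (d * d) ≤ m) :
    s.card * (d * Fintype.card V) ≤ ((s ×ˢ darts G Tᶜ Tᶜ).filter fun q =>
      ¬G.Adj q.1.1 q.2.1 ∧ ¬G.Adj q.1.2 q.2.2).card + s.card * m := by
  have h := le_card_filter_product s (darts G Tᶜ Tᶜ)
    (fun e f => ¬G.Adj e.1 f.1 ∧ ¬G.Adj e.2 f.2) (d * Fintype.card V - m) (fun e _ => by
      have := card_darts_avoiding hG T e.1 e.2
      refine Nat.sub_le_iff_le_add.2 (this.trans (Nat.add_le_add (le_of_eq (by congr!)) hm)))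
  have h' : s.card * (d * Fintype.card V) ≤ s.card * (d * Fintype.card V - m) + s.card * m := by
    rw [← mul_add]
    exact Nat.mul_le_mul_left _ (by omega)
  exact h'.trans (Nat.add_le_add_right (h.trans (le_of_eq (by congr!))) _)

/-- The inner ball survives the switching. Then `x` keeps its own access to it, which cannot pass
through `y`, and `y` is still reached from its second neighbour there. -/
theorem switchPair_mem_of_redundant {G : SimpleGraph V} {u x y z w : V} {i : ℕ}
    (h : Switchable G x y z w) (hr : (x, y) ∈ redundant G u i)
    (hz : z ∉ ball G u (i + 1)) (hw : w ∉ ball G u (i + 1)) :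
    x ∈ ball (switch G x y z w) u (i + 1) ∧ y ∈ ball (switch G x y z w) u (i + 1) := by
  simp only [redundant, Finset.mem_filter, Finset.mem_univ, true_and] at hr
  obtain ⟨hx, hy, hy', hxy, x', hx', hne, hx'y⟩ := hr
  have hm : ball G u i ⊆ ball G u (i + 1) := ball_mono (Nat.le_succ i)
  have hz' : z ∉ ball G u i := fun h => hz (hm h)
  have hw' : w ∉ ball G u i := fun h => hw (hm h)
  have hb : ball (switch G x y z w) u i = ball G u i :=
    ball_switch (notMem_ball_of_adj hxy hy') (notMem_ball_of_lt hy') (notMem_ball_of_lt hz')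
      (notMem_ball_of_lt hw') le_rfl
  constructor
  · rw [mem_ball_succ] at hx ⊢
    rw [hb]
    refine hx.imp_right ?_
    rintro ⟨q, hq, hqx⟩
    refine ⟨q, hq, ?_⟩
    have : q ≠ y := fun e => hy' (e ▸ hq)
    have : q ≠ z := fun e => hz' (e ▸ hq)
    have : q ≠ w := fun e => hw' (e ▸ hq)
    have := h.adj_left.ne
    rw [switch_adj]
    grind
  · rw [mem_ball_succ, hb]
    refine Or.inr ⟨x', hx', ?_⟩
    have : x' ≠ y := fun e => hy' (e ▸ hx')
    have : x' ≠ z := fun e => hz' (e ▸ hx')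
    have : x' ≠ w := fun e => hw' (e ▸ hx')
    rw [switch_adj]
    grind

/-- Switching a redundant dart with one of nearly `dn` far darts yields two darts that start in the
ball of the new graph, and the switching can be undone. The target has at most (`d` times the ball
size)² elements per graph, so the mean number of redundant darts is `O((d-1)^(2i+2)/n)`. -/
theorem sum_card_redundant_le {d : ℕ} (hd : 3 ≤ d) (u : V) (i : ℕ) :
    (∑ G ∈ regs V d, (redundant G u i).card) * (d * Fintype.card V) ≤
      (regs V d).card * (d * (d * (d - 1) ^ (i + 1))) ^ 2 +
      (∑ G ∈ regs V d, (redundant G u i).card) *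
        (2 * (d * (d * (d - 1) ^ (i + 1))) + 2 * (d * d)) := by
  set Q : SimpleGraph V → Finset ((V × V) × (V × V)) := fun G =>
    (redundant G u i ×ˢ darts G (ball G u (i + 1))ᶜ (ball G u (i + 1))ᶜ).filter fun q =>
      ¬G.Adj q.1.1 q.2.1 ∧ ¬G.Adj q.1.2 q.2.2 with hQ
  set R : SimpleGraph V → Finset ((V × V) × (V × V)) := fun G =>
    darts G (ball G u (i + 1)) Finset.univ ×ˢ darts G (ball G u (i + 1)) Finset.univ with hR
  have hsw : ∀ τ ∈ (regs V d).sigma Q, Switchable τ.1 τ.2.1.1 τ.2.1.2 τ.2.2.1 τ.2.2.2 := by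
    rintro ⟨G, ⟨x, y⟩, ⟨z, w⟩⟩ hτ
    simp only [hQ, Finset.mem_sigma, Finset.mem_filter, Finset.mem_product, mem_darts,
      Finset.mem_compl, redundant, Finset.mem_univ, true_and] at hτ
    obtain ⟨hG, ⟨⟨hx, hy, hy', hxy, -⟩, hz, hw, hzw⟩, h1, h2⟩ := hτ
    exact ⟨hxy, hzw, h1, h2, fun (e : x = z) => hz (e ▸ hx), fun (e : y = w) => hw (e ▸ hy)⟩
  have key : ((regs V d).sigma Q).card ≤ ((regs V d).sigma R).card := by
    refine Finset.card_le_card_of_injOn switchPair ?_ ?_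
    · rintro ⟨G, ⟨x, y⟩, ⟨z, w⟩⟩ hτ
      have h := hsw _ hτ
      simp only [hQ, Finset.coe_sigma, Set.mem_sigma_iff, Finset.mem_coe, Finset.mem_filter,
        Finset.mem_product, mem_darts, Finset.mem_compl] at hτ
      obtain ⟨hG, ⟨hr, hz, hw, hzw⟩, h1, h2⟩ := hτ
      have hmem := switchPair_mem_of_redundant h hr hz hw
      simp only [switchPair, hR, Finset.coe_sigma, Set.mem_sigma_iff, Finset.mem_coe,
        Finset.mem_product, mem_darts, Finset.mem_univ, true_and]
      exact ⟨mem_regs.2 (h.isReg (mem_regs.1 hG)), ⟨hmem.1, h.reverse.adj_left⟩,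
        ⟨hmem.2, h.reverse.adj_right⟩⟩
    · exact Set.LeftInvOn.injOn (f₁' := switchPair) fun τ hτ => switchPair_switchPair (hsw τ hτ)
  rw [Finset.card_sigma, Finset.card_sigma] at key
  have h1 : ∑ G ∈ regs V d, (R G).card ≤
      (regs V d).card * (d * (d * (d - 1) ^ (i + 1))) ^ 2 := by
    rw [← smul_eq_mul]
    refine Finset.sum_le_card_nsmul _ _ _ fun G hG => ?_
    rw [mem_regs] at hG
    rw [hR, Finset.card_product, card_darts_univ hG, ← sq]
    exact Nat.pow_le_pow_left (Nat.mul_le_mul_left _ (card_ball_le u (i + 1) hd hG)) 2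
  rw [Finset.sum_mul, Finset.sum_mul]
  refine le_trans (Finset.sum_le_sum fun G hG => ?_)
    ((Finset.sum_add_distrib).trans_le (Nat.add_le_add_right (key.trans h1) _))
  rw [mem_regs] at hG
  refine card_mul_le_card_darts_pairs hG (redundant G u i) (ball G u (i + 1)) ?_
  have := Nat.mul_le_mul_left d (card_ball_le u (i + 1) hd hG)
  omega

variable (V) in
/-- The `d`-regular graphs in which the balls of radius `a` around `u` and of radius `b` around `v`
are disjoint. -/
def separated (d : ℕ) (u v : V) (a b : ℕ) : Finset (SimpleGraph V) :=
  (regs V d).filter fun G => Disjoint (ball G u a) (ball G v b)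

/-- The edges joining the ball of radius `a` around `u` to the ball of radius `b` around `v`. -/
def links (G : SimpleGraph V) (u v : V) (a b : ℕ) : Finset (V × V) :=
  darts G (ball G u a) (ball G v b)

/-- The vertices outside both balls. -/
def outside (G : SimpleGraph V) (u v : V) (a b : ℕ) : Finset V :=
  (ball G u a ∪ ball G v b)ᶜ

theorem mem_outside {G : SimpleGraph V} {u v w : V} {a b : ℕ} :
    w ∈ outside G u v a b ↔ w ∉ ball G u a ∧ w ∉ ball G v b := by
  simp [outside]

/-- The pairs consisting of a link and a dart avoiding both balls that can be switched. -/
def removals (G : SimpleGraph V) (u v : V) (a b : ℕ) : Finset ((V × V) × (V × V)) :=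
  (links G u v a b ×ˢ darts G (outside G u v a b) (outside G u v a b)).filter fun q =>
    ¬G.Adj q.1.1 q.2.1 ∧ ¬G.Adj q.1.2 q.2.2

/-- The pairs of darts leaving both balls that can be switched to create a link. -/
def insertions (G : SimpleGraph V) (u v : V) (a b : ℕ) : Finset ((V × V) × (V × V)) :=
  (darts G (ball G u a) (outside G u v a b) ×ˢ darts G (ball G v b) (outside G u v a b)).filter
    fun q => Switchable G q.1.1 q.1.2 q.2.1 q.2.2

/-- As the balls are disjoint, the ends of a link lie on their outermost spheres, so the switching
touches nothing that determines the balls. The new edges end outside both balls and are not links.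
-/
theorem switch_removal {G : SimpleGraph V} {u v x y z w : V} {a b : ℕ}
    (hd : Disjoint (ball G u a) (ball G v b)) (h : Switchable G x y z w)
    (hx : x ∈ ball G u a) (hy : y ∈ ball G v b) (hz : z ∈ outside G u v a b)
    (hw : w ∈ outside G u v a b) :
    ball (switch G x y z w) u a = ball G u a ∧ ball (switch G x y z w) v b = ball G v b ∧
    (links (switch G x y z w) u v a b).card + 1 = (links G u v a b).card := by
  rw [mem_outside] at hz hw
  have hx' : x ∉ ball G v b := Finset.disjoint_left.1 hd hx
  have hy' : y ∉ ball G u a := Finset.disjoint_right.1 hd hy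
  have h1 : ball (switch G x y z w) u a = ball G u a :=
    ball_switch (notMem_ball_of_adj h.adj_left hy') (notMem_ball_of_lt hy')
      (notMem_ball_of_lt hz.1) (notMem_ball_of_lt hw.1) le_rfl
  have h2 : ball (switch G x y z w) v b = ball G v b :=
    ball_switch (notMem_ball_of_lt hx') (notMem_ball_of_adj h.adj_left.symm hx')
      (notMem_ball_of_lt hz.2) (notMem_ball_of_lt hw.2) le_rfl
  refine ⟨h1, h2, ?_⟩
  have hmem : (x, y) ∈ links G u v a b := mem_darts.2 ⟨hx, hy, h.adj_left⟩
  have : links (switch G x y z w) u v a b = (links G u v a b).erase (x, y) := by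
    ext ⟨p, q⟩
    simp only [links, h1, h2, mem_darts, Finset.mem_erase, switch_adj, ne_eq, Prod.mk.injEq]
    have := fun hp : p ∈ ball G u a => Finset.disjoint_left.1 hd hp
    grind
  rw [this, Finset.card_erase_add_one hmem]

theorem switch_insertion {G : SimpleGraph V} {u v x y z w : V} {a b : ℕ}
    (hd : Disjoint (ball G u a) (ball G v b)) (h : Switchable G x y z w)
    (hx : x ∈ ball G u a) (hz : z ∈ ball G v b) (hy : y ∈ outside G u v a b)
    (hw : w ∈ outside G u v a b) :
    ball (switch G x y z w) u a = ball G u a ∧ ball (switch G x y z w) v b = ball G v b ∧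
    (links (switch G x y z w) u v a b).card = (links G u v a b).card + 1 := by
  rw [mem_outside] at hy hw
  have hx' : x ∉ ball G v b := Finset.disjoint_left.1 hd hx
  have hz' : z ∉ ball G u a := Finset.disjoint_right.1 hd hz
  have h1 : ball (switch G x y z w) u a = ball G u a :=
    ball_switch (notMem_ball_of_adj h.adj_left hy.1) (notMem_ball_of_lt hy.1)
      (notMem_ball_of_lt hz') (notMem_ball_of_lt hw.1) le_rfl
  have h2 : ball (switch G x y z w) v b = ball G v b :=
    ball_switch (notMem_ball_of_lt hx') (notMem_ball_of_lt hy.2)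
      (notMem_ball_of_adj h.adj_right hw.2) (notMem_ball_of_lt hw.2) le_rfl
  refine ⟨h1, h2, ?_⟩
  have hmem : (x, z) ∉ links G u v a b := fun hm => h.not_adj_left (mem_darts.1 hm).2.2
  have : links (switch G x y z w) u v a b = insert (x, z) (links G u v a b) := by
    ext ⟨p, q⟩
    simp only [links, h1, h2, mem_darts, Finset.mem_insert, switch_adj, ne_eq, Prod.mk.injEq]
    have := fun hp : p ∈ ball G u a => Finset.disjoint_left.1 hd hp
    grind
  rw [this, Finset.card_insert_of_notMem hmem]

/-- Switching is a bijection between the two families and lowers the number of links by one, so the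
weights agree. The truncated exponent at zero links is harmless, as there are then no removals. -/
theorem sum_removals_eq_sum_insertions (d : ℕ) (u v : V) (a b : ℕ) (t : ℝ) :
    ∑ G ∈ separated V d u v a b,
      ((removals G u v a b).card : ℝ) * t ^ ((links G u v a b).card - 1) =
    ∑ G ∈ separated V d u v a b,
      ((insertions G u v a b).card : ℝ) * t ^ (links G u v a b).card := by
  have e : ∀ (Q : SimpleGraph V → Finset ((V × V) × (V × V))) (f : SimpleGraph V → ℝ),
      ∑ G ∈ separated V d u v a b, ((Q G).card : ℝ) * f G =
        ∑ τ ∈ (separated V d u v a b).sigma Q, f τ.1 := by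
    intro Q f
    rw [Finset.sum_sigma]
    simp
  rw [e (fun G => removals G u v a b) (fun G => t ^ ((links G u v a b).card - 1)),
    e (fun G => insertions G u v a b) (fun G => t ^ (links G u v a b).card)]
  have hrem : ∀ τ ∈ (separated V d u v a b).sigma (fun G => removals G u v a b),
      IsReg τ.1 d ∧ Disjoint (ball τ.1 u a) (ball τ.1 v b) ∧
      Switchable τ.1 τ.2.1.1 τ.2.1.2 τ.2.2.1 τ.2.2.2 ∧ τ.2.1.1 ∈ ball τ.1 u a ∧
      τ.2.1.2 ∈ ball τ.1 v b ∧ τ.2.2.1 ∈ outside τ.1 u v a b ∧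
      τ.2.2.2 ∈ outside τ.1 u v a b := by
    rintro ⟨G, ⟨x, y⟩, ⟨z, w⟩⟩ hτ
    simp only [removals, separated, links, Finset.mem_sigma, Finset.mem_filter,
      Finset.mem_product, mem_darts, mem_regs] at hτ ⊢
    obtain ⟨⟨hG, hd⟩, ⟨⟨hx, hy, hxy⟩, hz, hw, hzw⟩, h1, h2⟩ := hτ
    refine ⟨hG, hd, ⟨hxy, hzw, h1, h2, fun e => ?_, fun e => ?_⟩, hx, hy, hz, hw⟩
    · exact (mem_outside.1 hz).1 (e ▸ hx)
    · exact (mem_outside.1 hw).2 (e ▸ hy)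
  have hins : ∀ τ ∈ (separated V d u v a b).sigma (fun G => insertions G u v a b),
      IsReg τ.1 d ∧ Disjoint (ball τ.1 u a) (ball τ.1 v b) ∧
      Switchable τ.1 τ.2.1.1 τ.2.1.2 τ.2.2.1 τ.2.2.2 ∧ τ.2.1.1 ∈ ball τ.1 u a ∧
      τ.2.2.1 ∈ ball τ.1 v b ∧ τ.2.1.2 ∈ outside τ.1 u v a b ∧
      τ.2.2.2 ∈ outside τ.1 u v a b := by
    rintro ⟨G, ⟨x, y⟩, ⟨z, w⟩⟩ hτ
    simp only [insertions, separated, Finset.mem_sigma, Finset.mem_filter,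
      Finset.mem_product, mem_darts, mem_regs] at hτ ⊢
    obtain ⟨⟨hG, hd⟩, ⟨⟨hx, hy, hxy⟩, hz, hw, hzw⟩, h1⟩ := hτ
    exact ⟨hG, hd, h1, hx, hz, hy, hw⟩
  refine Finset.sum_bij' (fun τ _ => switchPair τ) (fun τ _ => switchPair τ) ?_ ?_ ?_ ?_ ?_
  · intro τ hτ
    obtain ⟨hG, hd, h, hx, hy, hz, hw⟩ := hrem τ hτ
    obtain ⟨h1, h2, h3⟩ := switch_removal hd h hx hy hz hw
    rw [mem_outside] at hz hw
    simp only [switchPair, insertions, separated, Finset.mem_sigma, Finset.mem_filter,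
      Finset.mem_product, mem_darts, mem_regs, h1, h2, mem_outside]
    exact ⟨⟨h.isReg hG, hd⟩, ⟨⟨hx, hz, h.reverse.adj_left⟩, hy, hw, h.reverse.adj_right⟩,
      h.reverse⟩
  · intro τ hτ
    obtain ⟨hG, hd, h, hx, hz, hy, hw⟩ := hins τ hτ
    obtain ⟨h1, h2, h3⟩ := switch_insertion hd h hx hz hy hw
    rw [mem_outside] at hy hw
    simp only [switchPair, removals, links, separated, Finset.mem_sigma, Finset.mem_filter,
      Finset.mem_product, mem_darts, mem_regs, h1, h2, mem_outside]
    exact ⟨⟨h.isReg hG, hd⟩, ⟨⟨hx, hz, h.reverse.adj_left⟩, hy, hw, h.reverse.adj_right⟩,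
      h.reverse.not_adj_left, h.reverse.not_adj_right⟩
  · intro τ hτ
    exact switchPair_switchPair (hrem τ hτ).2.2.1
  · intro τ hτ
    exact switchPair_switchPair (hins τ hτ).2.2.1
  · intro τ hτ
    obtain ⟨hG, hd, h, hx, hy, hz, hw⟩ := hrem τ hτ
    obtain ⟨h1, h2, h3⟩ := switch_removal hd h hx hy hz hw
    simp only [switchPair]
    rw [← h3]
    simp

theorem card_links_mul_le {G : SimpleGraph V} {d : ℕ} (hd : 3 ≤ d) (hG : IsReg G d) (u v : V)
    (a b : ℕ) :
    (links G u v a b).card * (d * Fintype.card V) ≤ (removals G u v a b).card +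
      (links G u v a b).card * (2 * (d * (d * (d - 1) ^ a + d * (d - 1) ^ b)) + 2 * (d * d)) := by
  refine card_mul_le_card_darts_pairs hG (links G u v a b) (ball G u a ∪ ball G v b) ?_
  have h := (Finset.card_union_le (ball G u a) (ball G v b)).trans
    (Nat.add_le_add (card_ball_le u a hd hG) (card_ball_le v b hd hG))
  have := Nat.mul_le_mul_left d h
  omega

theorem card_removals_le {G : SimpleGraph V} {d : ℕ} (hG : IsReg G d) (u v : V) (a b : ℕ) :
    (removals G u v a b).card ≤ (links G u v a b).card * (d * Fintype.card V) := by
  refine (Finset.card_filter_le _ _).trans ?_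
  rw [Finset.card_product]
  refine Nat.mul_le_mul_left _ ((card_darts_le hG _ _).trans (Nat.mul_le_mul_left _ ?_))
  exact Finset.card_le_univ _

theorem card_darts_outside {G : SimpleGraph V} {u v : V} {a b : ℕ}
    (hd : Disjoint (ball G u a) (ball G v b)) :
    (darts G (ball G u a) (outside G u v a b)).card + (links G u v a b).card = boundary G u a := by
  rw [← Finset.card_union_of_disjoint, boundary]
  · congr 1
    ext ⟨p, q⟩
    have : q ∈ ball G v b → q ∉ ball G u a := fun h => Finset.disjoint_right.1 hd h
    simp only [links, Finset.mem_union, mem_darts, mem_outside, Finset.mem_compl]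
    tauto
  · rw [Finset.disjoint_left]
    rintro ⟨p, q⟩
    simp only [links, mem_darts, mem_outside]
    tauto

theorem card_links_comm (G : SimpleGraph V) (u v : V) (a b : ℕ) :
    (links G u v a b).card = (links G v u b a).card :=
  card_darts_swap _ _ _

theorem outside_comm (G : SimpleGraph V) (u v : V) (a b : ℕ) :
    outside G u v a b = outside G v u b a := by
  rw [outside, outside, Finset.union_comm]

theorem card_insertions_le {G : SimpleGraph V} {d : ℕ} (hd1 : 1 ≤ d) (hG : IsReg G d) {u v : V}
    {a b : ℕ} (hd : Disjoint (ball G u a) (ball G v b)) :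
    (insertions G u v a b).card ≤ (d * (d - 1) ^ a) * (d * (d - 1) ^ b) := by
  have h1 := card_darts_outside hd
  have h2 := card_darts_outside hd.symm
  rw [← outside_comm] at h2
  refine (Finset.card_filter_le _ _).trans ?_
  rw [Finset.card_product]
  exact Nat.mul_le_mul ((by omega : _ ≤ boundary G u a).trans (boundary_le u a hd1 hG))
    ((by omega : _ ≤ boundary G v b).trans (boundary_le v b hd1 hG))

theorem boundary_mul_boundary_le {G : SimpleGraph V} {d : ℕ} (hd1 : 1 ≤ d) (hG : IsReg G d)
    {u v : V} {a b : ℕ} (hd : Disjoint (ball G u a) (ball G v b)) :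
    boundary G u a * boundary G v b ≤ (insertions G u v a b).card +
      (links G u v a b).card * (d * (d - 1) ^ a + d * (d - 1) ^ b) +
      (d * (d - 1) ^ a) * (2 * (d * d) + d) := by
  have h1 := card_darts_outside hd
  have h2 := card_darts_outside hd.symm
  rw [← outside_comm, ← card_links_comm] at h2
  have h3 := card_switchable_pairs hG hd (C := outside G u v a b)
  have h4 := boundary_le u a hd1 hG
  have h5 := boundary_le v b hd1 hG
  change _ ≤ (insertions G u v a b).card + _ at h3
  generalize (insertions G u v a b).card = I at *
  generalize (links G u v a b).card = Y at *
  generalize (darts G (ball G u a) (outside G u v a b)).card = H₁ at *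
  generalize (darts G (ball G v b) (outside G u v a b)).card = H₂ at *
  rw [← h1] at h4 ⊢
  rw [← h2] at h5 ⊢
  generalize d * (d - 1) ^ a = α at *
  generalize d * (d - 1) ^ b = β at *
  have h6 : H₁ * (2 * (d * d) + d) ≤ α * (2 * (d * d) + d) := Nat.mul_le_mul_right _ (by omega)
  have h7 : H₁ * Y ≤ α * Y := Nat.mul_le_mul_right _ (by omega)
  have h8 : (H₂ + Y) * Y ≤ β * Y := Nat.mul_le_mul_right _ h5
  -- With `H₁`, `H₂` the darts to the outside, the product of boundaries is `H₁H₂ + H₁Y + (H₂ +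
  -- Y)Y`, and the last two terms are at most `αY` and `βY`.
  nlinarith

end DoubleCounting

/-! ### The approximate differential equation for the link generating function -/

section Analysis

set_option linter.unusedSectionVars false

variable {V : Type*} [Fintype V] [DecidableEq V]

theorem sum_card_redundant_le_div {d : ℕ} (hd : 3 ≤ d) (u : V) (i : ℕ)
    (hn : 2 * (2 * (d * (d * (d - 1) ^ (i + 1))) + 2 * (d * d)) ≤ d * Fintype.card V) :
    (∑ G ∈ regs V d, ((redundant G u i).card : ℝ)) ≤
      (regs V d).card * (2 * d ^ 3 * (((d - 1 : ℕ) : ℝ) ^ (i + 1)) ^ 2 / Fintype.card V) := by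
  have h := sum_card_redundant_le hd u i
  set S := ∑ G ∈ regs V d, (redundant G u i).card with hS
  have hS' : (∑ G ∈ regs V d, ((redundant G u i).card : ℝ)) = S := by
    rw [hS]; push_cast; rfl
  rw [hS']
  have hV : 0 < Fintype.card V := Fintype.card_pos_iff.2 ⟨u⟩
  have h2 := Nat.mul_le_mul_left S hn
  have h3 : S * (d * Fintype.card V) ≤ 2 * ((regs V d).card * (d * (d * (d - 1) ^ (i + 1))) ^ 2) := by
    nlinarith
  have hd0 : (0 : ℝ) < d := by positivity
  have hV' : (0 : ℝ) < Fintype.card V := by exact_mod_cast hV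
  have h4 : (S : ℝ) * (d * Fintype.card V) ≤
      2 * ((regs V d).card * (d * (d * ((d - 1 : ℕ) : ℝ) ^ (i + 1))) ^ 2) := by exact_mod_cast h3
  rw [← mul_div_assoc, le_div_iff₀ hV']
  refine le_of_mul_le_mul_left ?_ hd0
  calc _ = (S : ℝ) * (d * Fintype.card V) := by ring
    _ ≤ _ := h4
    _ = _ := by ring

/-- The shortfall from tree growth is multiplied by `q = d - 1` at each radius and gains `d` per
redundant dart. The constant `4` reproduces itself because `4q + 2q² ≤ 4q²` for `q ≥ 2`. -/
theorem sum_defect_le {d : ℕ} (hd : 3 ≤ d) (u : V) (i : ℕ)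
    (hn : 2 * (2 * (d * (d * (d - 1) ^ i)) + 2 * (d * d)) ≤ d * Fintype.card V) :
    (∑ G ∈ regs V d, ((d : ℝ) * ((d - 1 : ℕ) : ℝ) ^ i - boundary G u i)) ≤
      (regs V d).card * (4 * d ^ 4 * (((d - 1 : ℕ) : ℝ) ^ i) ^ 2 / Fintype.card V) := by
  have hV' : (0 : ℝ) < Fintype.card V := by exact_mod_cast Fintype.card_pos_iff.2 ⟨u⟩
  induction i with
  | zero =>
    rw [Finset.sum_eq_zero]
    · positivity
    · intro G hG
      rw [boundary_zero (mem_regs.1 hG)]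
      simp
  | succ i ih =>
    have hq : (2 : ℝ) ≤ ((d - 1 : ℕ) : ℝ) := by exact_mod_cast (by omega : 2 ≤ d - 1)
    have hle : (d - 1) ^ i ≤ (d - 1) ^ (i + 1) := Nat.pow_le_pow_right (by omega) (Nat.le_succ i)
    have ih' := ih (le_trans (by gcongr) hn)
    have hr := sum_card_redundant_le_div hd u i hn
    have hstep : ∀ G ∈ regs V d, (d : ℝ) * ((d - 1 : ℕ) : ℝ) ^ (i + 1) - boundary G u (i + 1) ≤
        ((d - 1 : ℕ) : ℝ) * ((d : ℝ) * ((d - 1 : ℕ) : ℝ) ^ i - boundary G u i) +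
          d * (redundant G u i).card := by
      intro G hG
      have h : (((d - 1 : ℕ) : ℝ)) * boundary G u i ≤
          boundary G u (i + 1) + d * (redundant G u i).card := by
        exact_mod_cast mul_boundary_le u i (by omega) (mem_regs.1 hG)
      rw [pow_succ]
      linarith
    refine (Finset.sum_le_sum hstep).trans ?_
    rw [Finset.sum_add_distrib, ← Finset.mul_sum, ← Finset.mul_sum]
    generalize ((d - 1 : ℕ) : ℝ) = q at *
    have hx : (0 : ℝ) ≤ (regs V d).card * (d ^ 4 * (q ^ i) ^ 2 / Fintype.card V) := by positivity
    calc _ ≤ q * ((regs V d).card * (4 * d ^ 4 * (q ^ i) ^ 2 / Fintype.card V)) +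
          d * ((regs V d).card * (2 * d ^ 3 * (q ^ (i + 1)) ^ 2 / Fintype.card V)) := by
          gcongr
      _ = (4 * q + 2 * q ^ 2) * ((regs V d).card * (d ^ 4 * (q ^ i) ^ 2 / Fintype.card V)) := by
          rw [pow_succ]; ring
      _ ≤ (4 * q ^ 2) * ((regs V d).card * (d ^ 4 * (q ^ i) ^ 2 / Fintype.card V)) :=
          mul_le_mul_of_nonneg_right (by nlinarith) hx
      _ = _ := by rw [pow_succ]; ring

/-- The generating function of the number of links over the separated graphs. -/
def linkGen (V : Type*) [Fintype V] [DecidableEq V] (d : ℕ) (u v : V) (a b : ℕ) (t : ℝ) : ℝ :=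
  ∑ G ∈ separated V d u v a b, t ^ (links G u v a b).card

/-- The derivative of the generating function of the number of links. -/
def linkGenDeriv (V : Type*) [Fintype V] [DecidableEq V] (d : ℕ) (u v : V) (a b : ℕ) (t : ℝ) : ℝ :=
  ∑ G ∈ separated V d u v a b, ((links G u v a b).card : ℝ) * t ^ ((links G u v a b).card - 1)

theorem hasDerivAt_linkGen (d : ℕ) (u v : V) (a b : ℕ) (t : ℝ) :
    HasDerivAt (linkGen V d u v a b) (linkGenDeriv V d u v a b t) t :=
  HasDerivAt.fun_sum fun G _ => hasDerivAt_pow (links G u v a b).card t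

theorem linkGen_one (d : ℕ) (u v : V) (a b : ℕ) :
    linkGen V d u v a b 1 = (separated V d u v a b).card := by
  simp [linkGen]

theorem linkGen_zero (d : ℕ) (u v : V) (a b : ℕ) :
    linkGen V d u v a b 0 = ((separated V d u v a b).filter fun G => links G u v a b = ∅).card := by
  rw [linkGen, Finset.card_filter]
  push_cast
  refine Finset.sum_congr rfl fun G _ => ?_
  rw [zero_pow_eq]
  simp only [Finset.card_eq_zero]

theorem card_separated_le (d : ℕ) (u v : V) (a b : ℕ) :
    (separated V d u v a b).card ≤ (regs V d).card :=
  Finset.card_filter_le _ _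

theorem linkGenDeriv_mul_le {d : ℕ} (hd : 3 ≤ d) (u v : V) (a b : ℕ) {t : ℝ} (ht : 0 ≤ t) :
    linkGenDeriv V d u v a b t * (d * Fintype.card V) ≤
      (d * ((d - 1 : ℕ) : ℝ) ^ a) * (d * ((d - 1 : ℕ) : ℝ) ^ b) * linkGen V d u v a b t +
      linkGenDeriv V d u v a b t *
        (2 * (d * (d * ((d - 1 : ℕ) : ℝ) ^ a + d * ((d - 1 : ℕ) : ℝ) ^ b)) + 2 * (d * d)) := by
  have h1 : linkGenDeriv V d u v a b t * (d * Fintype.card V) ≤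
      (∑ G ∈ separated V d u v a b,
        ((removals G u v a b).card : ℝ) * t ^ ((links G u v a b).card - 1)) +
      linkGenDeriv V d u v a b t *
        (2 * (d * (d * ((d - 1 : ℕ) : ℝ) ^ a + d * ((d - 1 : ℕ) : ℝ) ^ b)) + 2 * (d * d)) := by
    rw [linkGenDeriv, Finset.sum_mul, Finset.sum_mul, ← Finset.sum_add_distrib]
    refine Finset.sum_le_sum fun G hG => ?_
    rw [separated, Finset.mem_filter, mem_regs] at hG
    have h : ((links G u v a b).card : ℝ) * (d * Fintype.card V) ≤ (removals G u v a b).card +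
      (links G u v a b).card *
        (2 * (d * (d * ((d - 1 : ℕ) : ℝ) ^ a + d * ((d - 1 : ℕ) : ℝ) ^ b)) + 2 * (d * d)) := by
      exact_mod_cast card_links_mul_le hd hG.1 u v a b
    have := mul_le_mul_of_nonneg_right h (pow_nonneg ht ((links G u v a b).card - 1))
    linarith
  refine h1.trans (add_le_add_left ?_ _)
  rw [sum_removals_eq_sum_insertions, linkGen, Finset.mul_sum]
  refine Finset.sum_le_sum fun G hG => ?_
  rw [separated, Finset.mem_filter, mem_regs] at hG
  refine mul_le_mul_of_nonneg_right ?_ (pow_nonneg ht _)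
  exact_mod_cast card_insertions_le (by omega) hG.1 hG.2

/-- The errors are, in order, the boundary defects at `u` and at `v`, the boundary edges that are
already links, and the dart pairs that cannot be switched. They are weighted by `t^(number of links)
≤ 1`, which is why the derivative at `1`, the total number of links, appears. -/
theorem le_linkGenDeriv_mul {d : ℕ} (hd : 3 ≤ d) (u v : V) (a b : ℕ) {t : ℝ} (ht : 0 ≤ t)
    (ht1 : t ≤ 1)
    (hna : 2 * (2 * (d * (d * (d - 1) ^ a)) + 2 * (d * d)) ≤ d * Fintype.card V)
    (hnb : 2 * (2 * (d * (d * (d - 1) ^ b)) + 2 * (d * d)) ≤ d * Fintype.card V) :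
    (d * ((d - 1 : ℕ) : ℝ) ^ a) * (d * ((d - 1 : ℕ) : ℝ) ^ b) * linkGen V d u v a b t ≤
      linkGenDeriv V d u v a b t * (d * Fintype.card V) +
      ((d * ((d - 1 : ℕ) : ℝ) ^ b) *
        ((regs V d).card * (4 * d ^ 4 * (((d - 1 : ℕ) : ℝ) ^ a) ^ 2 / Fintype.card V)) +
      (d * ((d - 1 : ℕ) : ℝ) ^ a) *
        ((regs V d).card * (4 * d ^ 4 * (((d - 1 : ℕ) : ℝ) ^ b) ^ 2 / Fintype.card V)) +
      linkGenDeriv V d u v a b 1 * (d * ((d - 1 : ℕ) : ℝ) ^ a + d * ((d - 1 : ℕ) : ℝ) ^ b) +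
      (regs V d).card * ((d * ((d - 1 : ℕ) : ℝ) ^ a) * (2 * (d * d) + d))) := by
  have hda := sum_defect_le hd u a hna
  have hdb := sum_defect_le hd v b hnb
  have hins : (∑ G ∈ separated V d u v a b,
      ((insertions G u v a b).card : ℝ) * t ^ (links G u v a b).card) ≤
      linkGenDeriv V d u v a b t * (d * Fintype.card V) := by
    rw [← sum_removals_eq_sum_insertions, linkGenDeriv, Finset.sum_mul]
    refine Finset.sum_le_sum fun G hG => ?_
    rw [separated, Finset.mem_filter, mem_regs] at hG
    have h : ((removals G u v a b).card : ℝ) ≤ (links G u v a b).card * (d * Fintype.card V) := by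
      exact_mod_cast card_removals_le hG.1 u v a b
    have := mul_le_mul_of_nonneg_right h (pow_nonneg ht ((links G u v a b).card - 1))
    linarith
  generalize hqd : ((d - 1 : ℕ) : ℝ) = q at *
  have hq : 0 ≤ q := hqd ▸ Nat.cast_nonneg _
  have hbu : ∀ G ∈ regs V d, 0 ≤ (d : ℝ) * q ^ a - boundary G u a := fun G hG => by
    rw [sub_nonneg, ← hqd]
    exact_mod_cast boundary_le u a (by omega) (mem_regs.1 hG)
  have hbv : ∀ G ∈ regs V d, 0 ≤ (d : ℝ) * q ^ b - boundary G v b := fun G hG => by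
    rw [sub_nonneg, ← hqd]
    exact_mod_cast boundary_le v b (by omega) (mem_regs.1 hG)
  have hsub : separated V d u v a b ⊆ regs V d := Finset.filter_subset _ _
  have hterm : ∀ G ∈ separated V d u v a b,
      (d * q ^ a) * (d * q ^ b) * t ^ (links G u v a b).card ≤
      ((insertions G u v a b).card : ℝ) * t ^ (links G u v a b).card +
      ((d * q ^ b) * (d * q ^ a - boundary G u a) + (d * q ^ a) * (d * q ^ b - boundary G v b) +
        (links G u v a b).card * (d * q ^ a + d * q ^ b) +
        (d * q ^ a) * (2 * (d * d) + d)) := by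
    intro G hG
    have hu := hbu G (hsub hG)
    have hv := hbv G (hsub hG)
    rw [separated, Finset.mem_filter, mem_regs] at hG
    have h : (boundary G u a : ℝ) * boundary G v b ≤ (insertions G u v a b).card +
        (links G u v a b).card * (d * q ^ a + d * q ^ b) + (d * q ^ a) * (2 * (d * d) + d) := by
      rw [← hqd]
      exact_mod_cast boundary_mul_boundary_le (by omega) hG.1 hG.2
    have h0 : (0 : ℝ) ≤ boundary G u a := Nat.cast_nonneg _
    have h0' : (0 : ℝ) ≤ boundary G v b := Nat.cast_nonneg _
    have hA : 0 ≤ d * q ^ a := by positivity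
    have hB : 0 ≤ d * q ^ b := by positivity
    set E := (d * q ^ b) * (d * q ^ a - boundary G u a) +
      (d * q ^ a) * (d * q ^ b - boundary G v b) +
        (links G u v a b).card * (d * q ^ a + d * q ^ b) +
        (d * q ^ a) * (2 * (d * d) + d) with hE
    have hE0 : 0 ≤ E := by positivity
    have hM : (d * q ^ a) * (d * q ^ b) ≤ (insertions G u v a b).card + E := by
      nlinarith [mul_nonneg hu hv]
    have hp := pow_nonneg ht (links G u v a b).card
    have hp1 := pow_le_one₀ ht ht1 (n := (links G u v a b).card)
    calc _ ≤ ((insertions G u v a b).card + E) * t ^ (links G u v a b).card :=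
          mul_le_mul_of_nonneg_right hM hp
      _ ≤ _ := by
          have := mul_le_mul_of_nonneg_left hp1 hE0
          linarith
  have hsum := Finset.sum_le_sum hterm
  rw [← Finset.mul_sum, Finset.sum_add_distrib, Finset.sum_add_distrib, Finset.sum_add_distrib,
    Finset.sum_add_distrib, ← Finset.mul_sum, ← Finset.mul_sum, ← Finset.sum_mul,
    Finset.sum_const, nsmul_eq_mul] at hsum
  have h1 : ∑ G ∈ separated V d u v a b, ((d : ℝ) * q ^ a - boundary G u a) ≤
      ∑ G ∈ regs V d, ((d : ℝ) * q ^ a - boundary G u a) :=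
    Finset.sum_le_sum_of_subset_of_nonneg hsub fun G hG _ => hbu G hG
  have h2 : ∑ G ∈ separated V d u v a b, ((d : ℝ) * q ^ b - boundary G v b) ≤
      ∑ G ∈ regs V d, ((d : ℝ) * q ^ b - boundary G v b) :=
    Finset.sum_le_sum_of_subset_of_nonneg hsub fun G hG _ => hbv G hG
  have h3 : ∑ G ∈ separated V d u v a b, ((links G u v a b).card : ℝ) =
      linkGenDeriv V d u v a b 1 := by simp [linkGenDeriv]
  rw [h3] at hsum
  have h4 : ((separated V d u v a b).card : ℝ) ≤ (regs V d).card := by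
    exact_mod_cast card_separated_le d u v a b
  refine hsum.trans (add_le_add hins ?_)
  have hA : 0 ≤ d * q ^ a := by positivity
  have hB : 0 ≤ d * q ^ b := by positivity
  gcongr
  · exact h1.trans hda
  · exact h2.trans hdb

theorem abs_deriv_sub_le {N s d κ A B c g g' g₁ n : ℝ} (hN : 0 ≤ N) (hd : 1 ≤ d) (hκ : 1 ≤ κ)
    (hs : 12 * d * κ ≤ s) (hn : n = s ^ 2) (hA0 : 0 ≤ A) (hB0 : 0 ≤ B)
    (hA : A ≤ d * κ * s) (hB : B ≤ d * κ * s) (hc : c = 2 * (d * (A + B)) + 2 * (d * d))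
    (hg' : 0 ≤ g') (hg'g₁ : g' ≤ g₁)
    (h1 : g' * (d * n) ≤ A * B * g + g' * c)
    (h1' : g₁ * (d * n) ≤ A * B * N + g₁ * c)
    (h2 : A * B * g ≤ g' * (d * n) + (B * (N * (4 * d ^ 2 * A ^ 2 / n)) +
      A * (N * (4 * d ^ 2 * B ^ 2 / n)) + g₁ * (A + B) + N * (A * (2 * (d * d) + d)))) :
    |g' - A * B / (d * n) * g| ≤ N * (15 * d ^ 4 * κ ^ 3 / s) := by
  have hs0 : 1 ≤ s := by nlinarith
  have hspos : 0 < s := by linarith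
  have hnpos : 0 < n := by rw [hn]; positivity
  have hP : 1 ≤ d * κ := by nlinarith
  have hc' : c ≤ 6 * d ^ 2 * κ * s := by
    have : d * d * 1 ≤ d * d * (κ * s) := by gcongr; nlinarith
    have : d * (A + B) ≤ d * (d * κ * s + d * κ * s) := by gcongr
    rw [hc]
    nlinarith
  -- The bound `12dκ ≤ s` enters here: `g₁c` can be absorbed into half of `g₁dn`, which bounds the
  -- mean number of links by `2dκ²`.
  have hcn : 2 * c ≤ d * n := by
    have : d * s * (12 * d * κ) ≤ d * s * s := by gcongr
    rw [hn]
    nlinarith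
  have hg₁0 : 0 ≤ g₁ := hg'.trans hg'g₁
  have hAB : A * B ≤ (d * κ * s) * (d * κ * s) := by gcongr
  have hg₁ : g₁ ≤ 2 * d * κ ^ 2 * N := by
    have e1 : g₁ * (d * n) ≤ 2 * (A * B * N) := by nlinarith
    have e2 : A * B * N ≤ (d * κ * s) * (d * κ * s) * N := by gcongr
    have e3 : g₁ * (d * n) ≤ (2 * d * κ ^ 2 * N) * (d * n) := by
      rw [hn] at e1 ⊢
      linarith
    exact le_of_mul_le_mul_right e3 (by positivity)
  have hc0 : 0 ≤ c := by rw [hc]; positivity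
  -- All errors are compared with `d⁵κ³sN`. Those of `h2` contribute `4 + 4 + 4 + 3 = 15`, and the
  -- single one of `h1` contributes at most `12`.
  have hpow : ∀ i j : ℕ, i ≤ 5 → j ≤ 3 → d ^ i * κ ^ j ≤ d ^ 5 * κ ^ 3 := fun i j hi hj => by
    gcongr
  have b1 : g' * c ≤ 15 * d ^ 5 * κ ^ 3 * s * N := by
    calc g' * c ≤ (2 * d * κ ^ 2 * N) * (6 * d ^ 2 * κ * s) := by
          gcongr; exact hg'g₁.trans hg₁
      _ = 12 * (d ^ 3 * κ ^ 3) * (s * N) := by ring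
      _ ≤ 12 * (d ^ 5 * κ ^ 3) * (s * N) := by gcongr; norm_num
      _ ≤ _ := by
        have : 0 ≤ d ^ 5 * κ ^ 3 * (s * N) := by positivity
        nlinarith
  have b2 : B * (N * (4 * d ^ 2 * A ^ 2 / n)) ≤ 4 * (d ^ 5 * κ ^ 3) * (s * N) := by
    calc _ ≤ (d * κ * s) * (N * (4 * d ^ 2 * (d * κ * s) ^ 2 / n)) := by gcongr
      _ = _ := by rw [hn]; field_simp
  have b3 : A * (N * (4 * d ^ 2 * B ^ 2 / n)) ≤ 4 * (d ^ 5 * κ ^ 3) * (s * N) := by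
    calc _ ≤ (d * κ * s) * (N * (4 * d ^ 2 * (d * κ * s) ^ 2 / n)) := by gcongr
      _ = _ := by rw [hn]; field_simp
  have b4 : g₁ * (A + B) ≤ 4 * (d ^ 5 * κ ^ 3) * (s * N) := by
    calc _ ≤ (2 * d * κ ^ 2 * N) * (d * κ * s + d * κ * s) := by gcongr
      _ = 4 * (d ^ 2 * κ ^ 3) * (s * N) := by ring
      _ ≤ _ := by gcongr; norm_num
  have b5 : N * (A * (2 * (d * d) + d)) ≤ 3 * (d ^ 5 * κ ^ 3) * (s * N) := by
    calc _ ≤ N * ((d * κ * s) * (2 * (d * d) + d * d)) := by gcongr; nlinarith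
      _ = 3 * (d ^ 3 * κ ^ 1) * (s * N) := by ring
      _ ≤ _ := by
        have := hpow 3 1 (by norm_num) (by norm_num)
        gcongr
  have hdn : 0 < d * n := by positivity
  have e : g' - A * B / (d * n) * g = (g' * (d * n) - A * B * g) / (d * n) := by
    field_simp
  have e' : N * (15 * d ^ 4 * κ ^ 3 / s) = 15 * d ^ 5 * κ ^ 3 * s * N / (d * n) := by
    rw [hn]; field_simp
  rw [e, e', abs_div, abs_of_pos hdn]
  gcongr
  rw [abs_le]
  constructor <;> linarith

/-- With the integrating factor `exp(-μt) ≤ 1`, the derivative is at most `ε` in absolute value on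
`[0, 1]`; the mean value inequality concludes. -/
theorem abs_sub_exp_mul_le {g g' : ℝ → ℝ} {μ ε : ℝ} (hμ : 0 ≤ μ)
    (hg : ∀ t, HasDerivAt g (g' t) t)
    (h : ∀ t, 0 ≤ t → t ≤ 1 → |g' t - μ * g t| ≤ ε) :
    |g 0 - Real.exp (-μ) * g 1| ≤ ε := by
  have hder : ∀ t, HasDerivAt (fun t => g t * Real.exp (-(μ * t)))
      ((g' t - μ * g t) * Real.exp (-(μ * t))) t := by
    intro t
    have h1 : HasDerivAt (fun t => -(μ * t)) (-μ) t := by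
      simpa using ((hasDerivAt_id' t).const_mul μ).fun_neg
    exact ((hg t).fun_mul h1.exp).congr_deriv (by ring)
  have := norm_image_sub_le_of_norm_deriv_le_segment_01'
    (f := fun t => g t * Real.exp (-(μ * t))) (C := ε)
    (fun t _ => (hder t).hasDerivWithinAt) (fun t ht => by
      rw [norm_mul, Real.norm_eq_abs, Real.norm_eq_abs, Real.abs_exp]
      have h1 := h t ht.1 ht.2.le
      have h2 : Real.exp (-(μ * t)) ≤ 1 := by
        rw [Real.exp_le_one_iff]
        have := mul_nonneg hμ ht.1
        linarith
      calc _ ≤ ε * 1 := mul_le_mul h1 h2 (Real.exp_pos _).le ((abs_nonneg _).trans h1)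
        _ = ε := mul_one ε)
  simp only [mul_one, mul_zero, neg_zero, Real.exp_zero, Real.norm_eq_abs] at this
  rw [abs_sub_comm, mul_comm (Real.exp (-μ))]
  exact this

theorem abs_card_unlinked_sub_le {d : ℕ} (hd : 3 ≤ d) (u v : V) (a b : ℕ) {κ : ℝ} (hκ : 1 ≤ κ)
    (hs : 12 * d * κ ≤ √(Fintype.card V))
    (ha : ((d - 1 : ℕ) : ℝ) ^ a ≤ κ * √(Fintype.card V))
    (hb : ((d - 1 : ℕ) : ℝ) ^ b ≤ κ * √(Fintype.card V)) :
    |(((separated V d u v a b).filter fun G => links G u v a b = ∅).card : ℝ) -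
      Real.exp (-(d * ((d - 1 : ℕ) : ℝ) ^ (a + b) / Fintype.card V)) *
        (separated V d u v a b).card| ≤
      (regs V d).card * (15 * d ^ 4 * κ ^ 3 / √(Fintype.card V)) := by
  rw [← linkGen_zero, ← linkGen_one]
  have hd1 : (1 : ℝ) ≤ d := by exact_mod_cast (by omega : 1 ≤ d)
  have hV : (Fintype.card V : ℝ) = √(Fintype.card V) ^ 2 := (Real.sq_sqrt (Nat.cast_nonneg _)).symm
  have hs1 : 1 ≤ √(Fintype.card V : ℝ) := by nlinarith
  have hsmall : ∀ i : ℕ, ((d - 1 : ℕ) : ℝ) ^ i ≤ κ * √(Fintype.card V) →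
      2 * (2 * (d * (d * (d - 1) ^ i)) + 2 * (d * d)) ≤ d * Fintype.card V := by
    intro i hi
    have : (2 : ℝ) * (2 * (d * (d * ((d - 1 : ℕ) : ℝ) ^ i)) + 2 * (d * d)) ≤
        d * Fintype.card V := by
      generalize ((d - 1 : ℕ) : ℝ) ^ i = α at *
      generalize √(Fintype.card V : ℝ) = s at *
      rw [hV]
      have e1 : (d : ℝ) * s * (12 * d * κ) ≤ d * s * s := by gcongr
      have e2 : (d : ℝ) * (d * α) ≤ d * (d * (κ * s)) := by gcongr
      have e3 : (d : ℝ) * d * 1 ≤ d * d * (κ * s) := by gcongr; nlinarith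
      have e4 : 0 ≤ (d : ℝ) * d * (κ * s) := by positivity
      nlinarith
    exact_mod_cast this
  refine abs_sub_exp_mul_le (g' := linkGenDeriv V d u v a b) (by positivity)
    (fun t => hasDerivAt_linkGen d u v a b t) fun t ht ht1 => ?_
  have h1 := linkGenDeriv_mul_le hd u v a b ht
  have h1' := linkGenDeriv_mul_le hd u v a b (zero_le_one (α := ℝ))
  have h2 := le_linkGenDeriv_mul hd u v a b ht ht1 (hsmall a ha) (hsmall b hb)
  have hg' : 0 ≤ linkGenDeriv V d u v a b t :=
    Finset.sum_nonneg fun G _ => mul_nonneg (Nat.cast_nonneg _) (pow_nonneg ht _)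
  have hg'1 : linkGenDeriv V d u v a b t ≤ linkGenDeriv V d u v a b 1 :=
    Finset.sum_le_sum fun G _ => mul_le_mul_of_nonneg_left (pow_le_pow_left₀ ht ht1 _)
      (Nat.cast_nonneg _)
  have hle : ((separated V d u v a b).card : ℝ) ≤ (regs V d).card := by
    exact_mod_cast card_separated_le d u v a b
  rw [linkGen_one] at h1'
  generalize hqd : ((d - 1 : ℕ) : ℝ) = q at *
  have hq : 0 ≤ q := hqd ▸ Nat.cast_nonneg _
  have key := abs_deriv_sub_le (N := (regs V d).card) (s := √(Fintype.card V)) (d := d) (κ := κ)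
    (A := d * q ^ a) (B := d * q ^ b) (Nat.cast_nonneg _) hd1 hκ hs hV (by positivity)
    (by positivity) (by rw [mul_assoc]; gcongr) (by rw [mul_assoc]; gcongr) rfl hg' hg'1 h1
    (h1'.trans (by gcongr)) (h2.trans_eq (by ring))
  have e : (d : ℝ) * q ^ a * (d * q ^ b) / (d * Fintype.card V) =
      d * q ^ (a + b) / Fintype.card V := by
    rw [pow_add]
    field_simp
  rwa [e] at key

end Analysis

/-! ### From one radius to the next, and up to distance `2r` -/

section Distance

set_option linter.unusedSectionVars false

variable {V : Type*} [Fintype V] [DecidableEq V]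

theorem disjoint_ball_succ_iff {G : SimpleGraph V} {u v : V} {a b : ℕ} :
    Disjoint (ball G u (a + 1)) (ball G v b) ↔
      Disjoint (ball G u a) (ball G v b) ∧ links G u v a b = ∅ := by
  constructor
  · intro h
    refine ⟨h.mono_left (ball_mono (Nat.le_succ a)), ?_⟩
    rw [Finset.eq_empty_iff_forall_notMem]
    rintro ⟨x, y⟩ hxy
    obtain ⟨hx, hy, hadj⟩ := mem_darts.1 hxy
    exact Finset.disjoint_left.1 h (mem_ball_of_adj (Nat.lt_succ_self a) hx hadj) hy
  · rintro ⟨h, he⟩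
    rw [Finset.disjoint_left]
    intro w hw hw'
    rcases mem_ball_succ.1 hw with hw | ⟨x, hx, hadj⟩
    · exact Finset.disjoint_left.1 h hw hw'
    · have : (x, w) ∈ links G u v a b := mem_darts.2 ⟨hx, hw', hadj⟩
      simp [he] at this

variable (V) in
/-- The number of `d`-regular graphs in which `u` and `v` are at distance greater than `m`. -/
def numFar (d : ℕ) (u v : V) (m : ℕ) : ℕ :=
  ((regs V d).filter fun G => v ∉ ball G u m).card

theorem card_separated (d : ℕ) (u v : V) (a b : ℕ) :
    (separated V d u v a b).card = numFar V d u v (a + b) := by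
  rw [separated, numFar]
  simp only [disjoint_ball_iff]

theorem card_unlinked (d : ℕ) (u v : V) (a b : ℕ) :
    ((separated V d u v a b).filter fun G => links G u v a b = ∅).card =
      numFar V d u v (a + b + 1) := by
  rw [separated, numFar, Finset.filter_filter, show a + b + 1 = a + 1 + b by omega]
  simp only [← disjoint_ball_iff, disjoint_ball_succ_iff]

theorem abs_numFar_succ_sub_le {d : ℕ} (hd : 3 ≤ d) (u v : V) {κ : ℝ} (hκ : 1 ≤ κ)
    (hs : 12 * d * κ ≤ √(Fintype.card V)) {r : ℕ}
    (hr : ((d - 1 : ℕ) : ℝ) ^ r ≤ κ * √(Fintype.card V)) {m : ℕ} (hm : m ≤ 2 * r) :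
    |(numFar V d u v (m + 1) : ℝ) -
      Real.exp (-(d * ((d - 1 : ℕ) : ℝ) ^ m / Fintype.card V)) * numFar V d u v m| ≤
      (regs V d).card * (15 * d ^ 4 * κ ^ 3 / √(Fintype.card V)) := by
  have hq : (1 : ℝ) ≤ ((d - 1 : ℕ) : ℝ) := by exact_mod_cast (by omega : 1 ≤ d - 1)
  -- Balanced radii are both at most `r` since `m ≤ 2r`, which keeps both balls of order `√n`.
  have h := abs_card_unlinked_sub_le hd u v (m / 2) (m - m / 2) hκ hs
    ((pow_le_pow_right₀ hq (by omega)).trans hr) ((pow_le_pow_right₀ hq (by omega)).trans hr)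
  rwa [card_unlinked, card_separated, show m / 2 + (m - m / 2) = m by omega] at h

/-- The one-step factors are at most `1`, so earlier errors are not amplified and the errors simply
add up. -/
theorem abs_numFar_sub_le {d : ℕ} (hd : 3 ≤ d) {u v : V} (huv : u ≠ v) {κ : ℝ} (hκ : 1 ≤ κ)
    (hs : 12 * d * κ ≤ √(Fintype.card V)) {r : ℕ}
    (hr : ((d - 1 : ℕ) : ℝ) ^ r ≤ κ * √(Fintype.card V)) {m : ℕ} (hm : m ≤ 2 * r) :
    |(numFar V d u v m : ℝ) -
      Real.exp (-∑ i ∈ Finset.range m, d * ((d - 1 : ℕ) : ℝ) ^ i / Fintype.card V) *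
        (regs V d).card| ≤
      m * ((regs V d).card * (15 * d ^ 4 * κ ^ 3 / √(Fintype.card V))) := by
  induction m with
  | zero =>
    have : numFar V d u v 0 = (regs V d).card := by
      rw [numFar, Finset.filter_true_of_mem]
      intro G _ h
      exact huv (mem_ball_zero.1 h).symm
    simp [this]
  | succ m ih =>
    have h1 := abs_numFar_succ_sub_le hd u v hκ hs hr (show m ≤ 2 * r by omega)
    have h2 := ih (by omega)
    rw [Finset.sum_range_succ, neg_add, Real.exp_add]
    set e := Real.exp (-(d * ((d - 1 : ℕ) : ℝ) ^ m / Fintype.card V)) with he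
    have he0 : 0 < e := Real.exp_pos _
    have he1 : e ≤ 1 := by
      rw [he, Real.exp_le_one_iff, neg_nonpos]
      positivity
    set X := Real.exp (-∑ i ∈ Finset.range m, d * ((d - 1 : ℕ) : ℝ) ^ i / Fintype.card V) *
      (regs V d).card with hX
    set ε := (regs V d).card * (15 * d ^ 4 * κ ^ 3 / √(Fintype.card V))
    have h3 : |e * (numFar V d u v m - X)| ≤ m * ε := by
      rw [abs_mul, abs_of_pos he0]
      exact (mul_le_of_le_one_left (abs_nonneg _) he1).trans h2
    have h4 := abs_add_le (numFar V d u v (m + 1) - e * numFar V d u v m : ℝ)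
      (e * (numFar V d u v m - X))
    rw [show (numFar V d u v (m + 1) - e * numFar V d u v m + e * (numFar V d u v m - X) : ℝ) =
      numFar V d u v (m + 1) - e * X by ring] at h4
    rw [mul_right_comm, mul_comm _ e, ← hX]
    push_cast
    linarith

theorem mem_ball_iff_exists_walk {G : SimpleGraph V} {u w : V} {i : ℕ} :
    w ∈ ball G u i ↔ ∃ p : G.Walk u w, p.length ≤ i := by
  constructor
  · intro h
    induction i generalizing w with
    | zero =>
      rw [mem_ball_zero] at h
      subst h
      exact ⟨.nil, by simp⟩
    | succ i ih =>
      rcases mem_ball_succ.1 h with h | ⟨x, hx, hadj⟩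
      · obtain ⟨p, hp⟩ := ih h
        exact ⟨p, by omega⟩
      · obtain ⟨p, hp⟩ := ih hx
        exact ⟨p.concat hadj, by simpa using hp⟩
  · rintro ⟨p, hp⟩
    refine ball_mono hp ?_
    clear hp
    induction p with
    | nil => exact mem_ball_zero.2 rfl
    | cons h p ih => exact mem_ball_succ_center.2 (Or.inr ⟨_, h.symm, ih⟩)

theorem nbhd_natCast (G : SimpleGraph V) (i : ℕ) (u : V) :
    nbhd G (i : ℤ) u = (ball G u i : Set V) := by
  ext w
  rw [Finset.mem_coe, mem_ball_iff_exists_walk, nbhd, Set.mem_ofPred_eq, Nat.cast_le]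
  constructor
  · rintro ⟨h, hi⟩
    obtain ⟨p, hp⟩ := h.exists_walk_length_eq_dist
    exact ⟨p, hp.trans_le hi⟩
  · rintro ⟨p, hp⟩
    exact ⟨⟨p⟩, (SimpleGraph.dist_le p).trans hp⟩

theorem nbhd_inter_nbhd_eq_empty_iff (G : SimpleGraph V) (r : ℕ) (u v : V) :
    nbhd G (r : ℤ) u ∩ nbhd G (r : ℤ) v = ∅ ↔ v ∉ ball G u (2 * r) := by
  rw [nbhd_natCast, nbhd_natCast, ← Set.disjoint_iff_inter_eq_empty, Finset.disjoint_coe,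
    disjoint_ball_iff, two_mul]

end Distance

/-! ### Averaging over the two vertices -/

section Probability

theorem regularGraphs_eq (n d : ℕ) : regularGraphs n d = regs (Fin n) d := by
  ext G
  rw [mem_regs, regularGraphs, Finset.mem_filter, IsReg]
  simp only [Finset.mem_univ, true_and, SimpleGraph.IsRegularOfDegree]
  refine forall_congr' fun v => ?_
  rw [← SimpleGraph.card_neighborFinset_eq_degree]
  refine Eq.congr_left (congrArg _ ?_)
  ext w
  simp

theorem prob_eq (n d r : ℕ) :
    prob n d (fun G u v => nbhd G (r : ℤ) u ∩ nbhd G (r : ℤ) v = ∅) =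
      (∑ u : Fin n, ∑ v : Fin n, (numFar (Fin n) d u v (2 * r) : ℝ)) /
        ((regs (Fin n) d).card * n ^ 2) := by
  rw [prob]
  congr 1
  · rw [sampleSpace, Finset.card_filter, Finset.sum_product, Finset.sum_comm,
      ← Finset.univ_product_univ, Finset.sum_product]
    push_cast
    refine Finset.sum_congr rfl fun u _ => Finset.sum_congr rfl fun v _ => ?_
    rw [numFar, Finset.card_filter, regularGraphs_eq]
    push_cast
    refine Finset.sum_congr rfl fun G _ => ?_
    simp only [nbhd_inter_nbhd_eq_empty_iff]
  · rw [sampleSpace, Finset.card_product, regularGraphs_eq]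
    simp [sq]

theorem abs_prob_sub_le {n d : ℕ} (hd : 3 ≤ d) (hne : (regs (Fin n) d).Nonempty) {κ : ℝ}
    (hκ : 1 ≤ κ) (hs : 12 * d * κ ≤ √n) {r : ℕ} (hr : ((d - 1 : ℕ) : ℝ) ^ r ≤ κ * √n) :
    |prob n d (fun G u v => nbhd G (r : ℤ) u ∩ nbhd G (r : ℤ) v = ∅) -
      Real.exp (-∑ i ∈ Finset.range (2 * r), d * ((d - 1 : ℕ) : ℝ) ^ i / n)| ≤
      2 * r * (15 * d ^ 4 * κ ^ 3 / √n) + 1 / n := by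
  have hs0 : 0 < √(n : ℝ) := by
    have : (1 : ℝ) ≤ d := by exact_mod_cast (by omega : 1 ≤ d)
    have : 0 < 12 * d * κ := by positivity
    linarith
  have hn : (0 : ℝ) < n := Real.sqrt_pos.1 hs0
  set X := Real.exp (-∑ i ∈ Finset.range (2 * r), d * ((d - 1 : ℕ) : ℝ) ^ i / n) with hX
  have hX0 : 0 < X := Real.exp_pos _
  have hX1 : X ≤ 1 := by
    rw [hX, Real.exp_le_one_iff, neg_nonpos]
    positivity
  set N := ((regs (Fin n) d).card : ℝ) with hN
  have hN0 : 0 < N := by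
    rw [hN]; exact_mod_cast Finset.card_pos.2 hne
  set ε := 15 * d ^ 4 * κ ^ 3 / √n with hε
  have hε0 : 0 ≤ ε := by positivity
  -- On the diagonal the count is `0` and the error is at most `N`; after averaging this gives the
  -- term `1/n`.
  have hterm : ∀ u v : Fin n, |(numFar (Fin n) d u v (2 * r) : ℝ) - X * N| ≤
      2 * r * (N * ε) + if u = v then N else 0 := by
    intro u v
    split_ifs with h
    · subst h
      have : numFar (Fin n) d u u (2 * r) = 0 := by
        rw [numFar, Finset.card_eq_zero, Finset.filter_eq_empty_iff]
        intro G _ h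
        exact h (ball_mono (Nat.zero_le _) (mem_ball_zero.2 rfl))
      rw [this, Nat.cast_zero, zero_sub, abs_neg, abs_of_pos (by positivity)]
      have : X * N ≤ 1 * N := by gcongr
      have : 0 ≤ 2 * r * (N * ε) := by positivity
      linarith
    · have := abs_numFar_sub_le hd h hκ (by simpa using hs) (by simpa using hr)
        (le_refl (2 * r))
      simpa [hX, hN, hε] using this
  have hsum : |(∑ u : Fin n, ∑ v : Fin n, (numFar (Fin n) d u v (2 * r) : ℝ)) - n ^ 2 * (X * N)| ≤
      n ^ 2 * (2 * r * (N * ε)) + n * N := by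
    have e1 : (∑ u : Fin n, ∑ v : Fin n, (numFar (Fin n) d u v (2 * r) : ℝ)) - n ^ 2 * (X * N) =
        ∑ u : Fin n, ∑ v : Fin n, ((numFar (Fin n) d u v (2 * r) : ℝ) - X * N) := by
      simp [Finset.sum_sub_distrib]
      ring
    have e2 : (n : ℝ) ^ 2 * (2 * r * (N * ε)) + n * N =
        ∑ u : Fin n, ∑ v : Fin n, (2 * r * (N * ε) + if u = v then N else 0) := by
      simp [Finset.sum_add_distrib]
      ring
    rw [e1, e2]
    refine (Finset.abs_sum_le_sum_abs _ _).trans (Finset.sum_le_sum fun u _ => ?_)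
    exact (Finset.abs_sum_le_sum_abs _ _).trans (Finset.sum_le_sum fun v _ => hterm u v)
  rw [prob_eq, ← hN]
  have hD : 0 < N * (n : ℝ) ^ 2 := by positivity
  have e3 : (∑ u : Fin n, ∑ v : Fin n, (numFar (Fin n) d u v (2 * r) : ℝ)) / (N * n ^ 2) - X =
      ((∑ u : Fin n, ∑ v : Fin n, (numFar (Fin n) d u v (2 * r) : ℝ)) - n ^ 2 * (X * N)) /
        (N * n ^ 2) := by
    field_simp
  have e4 : 2 * r * ε + 1 / n = (n ^ 2 * (2 * r * (N * ε)) + n * N) / (N * (n : ℝ) ^ 2) := by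
    field_simp
  rw [e3, e4, abs_div, abs_of_pos hD]
  gcongr

end Probability

/-! ### Existence of regular graphs -/

section Existence

/-- This is the connection set of a circulant graph: `±1, …, ±m`, together with the self-inverse
jump `n/2` when `d` is odd, in which case `n` is even. -/
theorem exists_symmetric_jumps {n d : ℕ} (hdn : d < n) (he : Even (d * n)) :
    ∃ T : Finset ℕ, (∀ t ∈ T, 0 < t ∧ t < n ∧ n - t ∈ T) ∧ T.card = d := by
  obtain ⟨m, rfl | rfl⟩ := Nat.even_or_odd' d
  · refine ⟨Finset.Icc 1 m ∪ Finset.Icc (n - m) (n - 1), ?_, ?_⟩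
    · intro t ht
      simp only [Finset.mem_union, Finset.mem_Icc] at ht ⊢
      omega
    · rw [Finset.card_union_of_disjoint, Nat.card_Icc, Nat.card_Icc]
      · omega
      · rw [Finset.disjoint_left]
        intro t
        simp only [Finset.mem_Icc]
        omega
  · have hn : Even n := by
      rcases Nat.even_mul.1 he with h | h
      · exact absurd h (by simp)
      · exact h
    obtain ⟨k, rfl⟩ := hn
    refine ⟨insert k (Finset.Icc 1 m ∪ Finset.Icc (k + k - m) (k + k - 1)), ?_, ?_⟩
    · intro t ht
      simp only [Finset.mem_insert, Finset.mem_union, Finset.mem_Icc] at ht ⊢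
      omega
    · rw [Finset.card_insert_of_notMem, Finset.card_union_of_disjoint, Nat.card_Icc, Nat.card_Icc]
      · omega
      · rw [Finset.disjoint_left]
        intro t
        simp only [Finset.mem_Icc]
        omega
      · simp only [Finset.mem_union, Finset.mem_Icc]
        omega

theorem regs_nonempty {n d : ℕ} (hdn : d < n) (he : Even (d * n)) : (regs (Fin n) d).Nonempty := by
  obtain ⟨T, hT, hcard⟩ := exists_symmetric_jumps hdn he
  have : NeZero n := ⟨by omega⟩
  have hneg : ∀ x : Fin n, (x : ℕ) ∈ T → ((-x : Fin n) : ℕ) ∈ T := by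
    intro x hx
    obtain ⟨h1, h2, h3⟩ := hT _ hx
    rw [Fin.val_neg']
    rwa [Nat.mod_eq_of_lt (by omega)]
  let G : SimpleGraph (Fin n) :=
    { Adj := fun u v => ((v - u : Fin n) : ℕ) ∈ T
      symm := ⟨fun u v h => by
        have := hneg _ h
        rwa [neg_sub] at this⟩
      loopless := ⟨fun u h => by
        have := (hT _ h).1
        simp at this⟩ }
  refine ⟨G, mem_regs.2 fun u => ?_⟩
  rw [← hcard, ← Finset.card_attachFin T (fun t ht => (hT t ht).2.1)]
  refine Finset.card_bij' (fun v _ => v - u) (fun x _ => x + u) ?_ ?_ ?_ ?_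
  · intro v hv
    simpa [G] using hv
  · intro v hv
    simpa [G] using hv
  · intro v _
    simp
  · intro v _
    simp

end Existence

/-! ### Evaluating the exponent and the error terms -/

section Asymptotics

theorem sum_geom_div_eq {d n r : ℕ} (hd : 3 ≤ d) {g : ℝ} (hn : 0 < n)
    (hr : (((d - 1 : ℕ) : ℝ) ^ r) ^ 2 = n * g) :
    ∑ i ∈ Finset.range (2 * r), (d : ℝ) * ((d - 1 : ℕ) : ℝ) ^ i / n =
      d * g / (d - 2) - d / (d - 2) / n := by
  have hn' : (n : ℝ) ≠ 0 := by positivity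
  have hd' : (3 : ℝ) ≤ d := by exact_mod_cast hd
  have h2 : (d : ℝ) - 2 ≠ 0 := by linarith
  have hq : ((d - 1 : ℕ) : ℝ) = d - 1 := by
    rw [Nat.cast_sub (by omega), Nat.cast_one]
  rw [← Finset.sum_div, ← Finset.mul_sum, geom_sum_eq (by rw [hq]; linarith), mul_comm 2 r,
    pow_mul, hr, hq]
  rw [show (d : ℝ) - 1 - 1 = d - 2 by ring]
  field_simp

theorem pow_radius_sq {d n r : ℕ} (hd : 3 ≤ d) (hn : 0 < n) {k : ℤ} (hr : (r : ℤ) = i₀ n d + k) :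
    (((d - 1 : ℕ) : ℝ) ^ r) ^ 2 = n * ((d : ℝ) - 1) ^ (2 * (k : ℝ) - 2 * γ n d) := by
  have hd' : (3 : ℝ) ≤ d := by exact_mod_cast hd
  have hq : ((d - 1 : ℕ) : ℝ) = d - 1 := by
    rw [Nat.cast_sub (by omega), Nat.cast_one]
  have hr' : (r : ℝ) = i₀ n d + k := by exact_mod_cast hr
  have hq0 : 0 < (d : ℝ) - 1 := by linarith
  have hlog : ((d : ℝ) - 1) ^ Real.logb ((d : ℝ) - 1) n = n :=
    Real.rpow_logb hq0 (by linarith) (by exact_mod_cast hn)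
  rw [hq, ← pow_mul, ← Real.rpow_natCast]
  rw [show (n : ℝ) * ((d : ℝ) - 1) ^ (2 * (k : ℝ) - 2 * γ n d) =
    ((d : ℝ) - 1) ^ Real.logb ((d : ℝ) - 1) n * ((d : ℝ) - 1) ^ (2 * (k : ℝ) - 2 * γ n d) by
      rw [hlog], ← Real.rpow_add hq0]
  congr 1
  push_cast
  rw [hr', γ]
  ring

theorem γ_nonneg (n d : ℕ) : 0 ≤ γ n d := sub_nonneg.2 (Int.floor_le _)

/-- A bound independent of `n`, from `γ ≥ 0`. It keeps the limit expression away from `0` and bounds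
the balls by a constant times `√n`. -/
theorem rpow_exponent_le {d : ℕ} (hd : 3 ≤ d) (n : ℕ) (k : ℤ) :
    ((d : ℝ) - 1) ^ (2 * (k : ℝ) - 2 * γ n d) ≤ (((d : ℝ) - 1) ^ |(k : ℝ)|) ^ 2 := by
  have hd' : (3 : ℝ) ≤ d := by exact_mod_cast hd
  rw [← Real.rpow_natCast, ← Real.rpow_mul (by linarith)]
  refine Real.rpow_le_rpow_of_exponent_le (by linarith) ?_
  have := γ_nonneg n d
  have := le_abs_self (k : ℝ)
  push_cast
  linarith

theorem pow_radius_le {d n r : ℕ} (hd : 3 ≤ d) (hn : 0 < n) {k : ℤ} (hr : (r : ℤ) = i₀ n d + k) :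
    ((d - 1 : ℕ) : ℝ) ^ r ≤ ((d : ℝ) - 1) ^ |(k : ℝ)| * √n := by
  have hd' : (3 : ℝ) ≤ d := by exact_mod_cast hd
  have hq0 : 0 < (d : ℝ) - 1 := by linarith
  refine le_of_sq_le_sq ?_ (by positivity)
  rw [pow_radius_sq hd hn hr, mul_pow, Real.sq_sqrt (Nat.cast_nonneg n), mul_comm]
  exact mul_le_mul_of_nonneg_right (rpow_exponent_le hd n k) (Nat.cast_nonneg n)

theorem two_mul_radius_le {d n r : ℕ} {k : ℤ} (hr : (r : ℤ) = i₀ n d + k) :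
    2 * (r : ℝ) ≤ Real.log n / Real.log ((d : ℝ) - 1) + 2 * |(k : ℝ)| := by
  have hr' : (r : ℝ) = i₀ n d + k := by exact_mod_cast hr
  have h1 : (i₀ n d : ℝ) ≤ (1 / 2 : ℝ) * Real.logb ((d : ℝ) - 1) (n : ℝ) := Int.floor_le _
  have h2 := le_abs_self (k : ℝ)
  rw [hr', Real.log_div_log]
  linarith

theorem tendsto_log_div_sqrt_nat : Tendsto (fun n : ℕ => Real.log n / √n) atTop (𝓝 0) := by
  have h := (isLittleO_log_rpow_atTop (r := 1 / 2) (by norm_num)).tendsto_div_nhds_zero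
  simp only [← Real.sqrt_eq_rpow] at h
  exact h.comp tendsto_natCast_atTop_atTop

theorem tendsto_sqrt_nat : Tendsto (fun n : ℕ => √(n : ℝ)) atTop atTop :=
  Real.tendsto_sqrt_atTop.comp tendsto_natCast_atTop_atTop

theorem tendsto_error (A B C D : ℝ) :
    Tendsto (fun n : ℕ => ((Real.log n / A + B) * (C / √n) + 1 / n) * D) atTop (𝓝 0) := by
  have h1 := tendsto_log_div_sqrt_nat.const_mul (C / A)
  have h2 := (tendsto_inv_atTop_zero.comp tendsto_sqrt_nat).const_mul (B * C)
  have h3 := tendsto_one_div_atTop_nhds_zero_nat (𝕜 := ℝ)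
  have h := ((h1.add h2).add h3).mul_const D
  simp only [mul_zero, add_zero, zero_mul] at h
  refine h.congr fun n => ?_
  simp only [Function.comp]
  ring

end Asymptotics

end RandomRegular

end


/-! ### The asymptotic equivalence -/

theorem lemma2p3 (d : ℕ) (hd : 3 ≤ d) (k : ℤ) :
    Asymptotics.IsEquivalent (RandomRegular.atTopEven d)
      (fun n : ℕ => RandomRegular.prob n d fun G u v =>
        RandomRegular.nbhd G (RandomRegular.i₀ n d + k) u ∩
          RandomRegular.nbhd G (RandomRegular.i₀ n d + k) v = ∅)
      (fun n : ℕ => Real.exp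
        (-((d : ℝ) * ((d : ℝ) - 1) ^ (2 * (k : ℝ) - 2 * RandomRegular.γ n d) / ((d : ℝ) - 2)))) := by
  have hd' : (3 : ℝ) ≤ d := by exact_mod_cast hd
  have hq1 : 1 < (d : ℝ) - 1 := by linarith
  have hd2 : 0 < (d : ℝ) - 2 := by linarith
  set κ : ℝ := ((d : ℝ) - 1) ^ |(k : ℝ)| with hκ
  have hκ1 : 1 ≤ κ := Real.one_le_rpow hq1.le (abs_nonneg _)
  set c : ℝ := d / (d - 2) with hc
  refine isEquivalent_of_tendsto_one ?_
  rw [tendsto_iff_norm_sub_tendsto_zero]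
  have herr : Tendsto (fun n : ℕ =>
      ((Real.log n / Real.log ((d : ℝ) - 1) + 2 * |(k : ℝ)|) * (15 * d ^ 4 * κ ^ 3 / √n) + 1 / n) *
        Real.exp (d * κ ^ 2 / (d - 2)) + |Real.exp (c / n) - 1|)
      (RandomRegular.atTopEven d) (𝓝 0) := by
    refine Tendsto.mono_left ?_ inf_le_left
    have h1 := (Real.continuous_exp.tendsto _).comp (tendsto_const_div_atTop_nhds_zero_nat c)
    have h2 := (h1.sub_const 1).abs
    have h3 := (RandomRegular.tendsto_error (Real.log ((d : ℝ) - 1)) (2 * |(k : ℝ)|)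
      (15 * d ^ 4 * κ ^ 3) (Real.exp (d * κ ^ 2 / (d - 2)))).add h2
    simpa using h3
  have hradius : Tendsto (fun n : ℕ => (1 / 2 : ℝ) * Real.logb ((d : ℝ) - 1) n) atTop atTop :=
    ((Real.tendsto_logb_atTop hq1).comp tendsto_natCast_atTop_atTop).const_mul_atTop (by norm_num)
  refine squeeze_zero' (Eventually.of_forall fun _ => norm_nonneg _) ?_ herr
  rw [RandomRegular.atTopEven, eventually_inf_principal]
  filter_upwards [eventually_gt_atTop d, RandomRegular.tendsto_sqrt_nat.eventually_ge_atTop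
    (12 * d * κ), hradius.eventually_ge_atTop ((-k : ℤ) : ℝ)] with n hdn hs hk he
  have hn : 0 < n := by omega
  -- For large `n` the radius is nonnegative even when `k < 0`, since `i₀` tends to infinity.
  obtain ⟨r, hr⟩ : ∃ r : ℕ, (r : ℤ) = RandomRegular.i₀ n d + k := by
    have : -k ≤ RandomRegular.i₀ n d := Int.le_floor.2 hk
    exact ⟨(RandomRegular.i₀ n d + k).toNat, Int.toNat_of_nonneg (by omega)⟩
  have hmain := RandomRegular.abs_prob_sub_le hd (RandomRegular.regs_nonempty hdn he) hκ1 hs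
    (RandomRegular.pow_radius_le hd hn hr)
  rw [RandomRegular.sum_geom_div_eq hd hn (RandomRegular.pow_radius_sq hd hn hr)] at hmain
  have hexp := RandomRegular.rpow_exponent_le hd n k
  have hrad := RandomRegular.two_mul_radius_le hr
  rw [← hκ] at hexp
  simp only [Pi.div_apply, Real.norm_eq_abs]
  rw [← hr]
  set P := RandomRegular.prob n d fun G u v =>
    RandomRegular.nbhd G (r : ℤ) u ∩ RandomRegular.nbhd G (r : ℤ) v = ∅
  set g := ((d : ℝ) - 1) ^ (2 * (k : ℝ) - 2 * RandomRegular.γ n d)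
  set Y := Real.exp (-(d * g / ((d : ℝ) - 2))) with hY
  have hY0 : 0 < Y := Real.exp_pos _
  rw [neg_sub, sub_eq_add_neg (_ / _ / _), Real.exp_add, ← hY, ← hc] at hmain
  have hYinv : Y⁻¹ ≤ Real.exp (d * κ ^ 2 / (d - 2)) := by
    rw [hY, Real.exp_neg, inv_inv]
    gcongr
  -- The factor `exp(c/n)` comes from the `-1` in the geometric sum. Dividing by `Y` makes the error
  -- relative, and `Y⁻¹` is bounded uniformly in `n`.
  have e : P / Y - 1 = (P - Real.exp (c / n) * Y) * Y⁻¹ + (Real.exp (c / n) - 1) := by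
    field_simp
    ring
  rw [e]
  refine (abs_add_le _ _).trans (add_le_add_left ?_ _)
  rw [abs_mul, abs_of_pos (inv_pos.2 hY0)]
  have hrad' : 2 * (r : ℝ) * (15 * d ^ 4 * κ ^ 3 / √n) + 1 / n ≤
      (Real.log n / Real.log ((d : ℝ) - 1) + 2 * |(k : ℝ)|) * (15 * d ^ 4 * κ ^ 3 / √n) + 1 / n := by
    gcongr
  exact mul_le_mul (hmain.trans hrad') hYinv (inv_pos.2 hY0).le
    (le_trans (abs_nonneg _) (hmain.trans hrad'))
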